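/- **Setting.** Let $\widetilde{\mathbb C}$ be the ring of complex generalized numbers: nets $(a_\varepsilon)_{\varepsilon\in(0,1]}$ of complex numbers with $|a_\varepsilon|=O(\varepsilon^{-N})$ as $\varepsilon\to0$ for some $N\in\mathbb N$, modulo those with $|a_\varepsilon|=O(\varepsilon^{q})$ for all $q\in\mathbb N$. Let $n\ge 1$ and let $\mathcal G(\mathbb R^n)$ be the Colombeau algebra: nets $(u_\varepsilon)_\varepsilon$ in $C^\infty(\mathbb R^n)$ such that for all compact $K$ and all $i\in\mathbb N$ the seminorm $p_{K,i}(u_\varepsilon)=\sup_{x\in K,|\alpha|\le i}|\partial^\alpha u_\varepsilon(x)|$ is $O(\varepsilon^{-N})$ for some $N$, modulo the nets for which all $p_{K,i}(u_\varepsilon)$ are $O(\varepsilon^q)$ for all $q$. Both are topologized by the ultra-pseudo-seminorms $e^{-\mathrm{val}_p(u)}$, where $\mathrm{val}_p(u)=\sup\{b\in\mathbb R: p(u_\varepsilon)=O(\varepsilon^b)\}$, with $p=|\cdot|$, respectively $p=p_{K,i}$. The support $\mathrm{supp}\,u$ is the complement of the union of all open $V$ with $u|_V=0$. Let $\mathcal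 G_c(\mathbb R^n)$ be the $\widetilde{\mathbb C}$-submodule of the compactly supported elements of $\mathcal G(\mathbb R^n)$, with the inductive limit topology: the finest locally convex topological $\widetilde{\mathbb C}$-module topology (a topological module topology with a base of neighbourhoods $A$ of $0$ such that $A+A\subseteq A$) for which the inclusions of $\mathcal G_K(\mathbb R^n)=\{u:\mathrm{supp}\,u\subseteq K\}$, $K$ compact, topologized by the $e^{-\mathrm{val}_{p_{K',i}}}$ with $K\subseteq\mathrm{int}\,K'$, are continuous. Let $\mathcal L(\mathcal G_c(\mathbb R^n),\widetilde{\mathbb C})$ and $\mathcal L(\mathcal G(\mathbb R^n),\widetilde{\mathbb C})$ be the spaces of continuous $\widetilde{\mathbb C}$-linear functionals; the latter is regarded as a subspace of the former by restriction. The support of $T\in\mathcal L(\mathcal G_c(\mathbb R^n),\widetilde{\mathbb C})$ is the complement of the union of all open $V$ such that $T(w)=0$ whenever $\mathrm{supp}\,w\subseteq V$. $T$ is *basic* if there is a net of distributions $T_\varepsilon\in\mathcal D'(\mathbb R^n)$ such that for every compact $K$ there are $j,N\in\mathbb N$, $c>0$, $\eta\in(0,1]$ with $|T_\varepsilon(f)|\le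 c\,\varepsilon^{-N}p_{K,j}(f)$ for all smooth $f$ supported in $K$ and all $\varepsilon\le\eta$, and $T([(w_\varepsilon)_\varepsilon])=[(T_\varepsilon(w_\varepsilon))_\varepsilon]$ for representatives $(w_\varepsilon)_\varepsilon$ supported in a common compact set. Let $P(D)=\sum_{|\alpha|\le m}c_\alpha D^\alpha$ with $c_\alpha\in\widetilde{\mathbb C}$, $D_j=-i\partial_j$. It acts on $\mathcal G(\mathbb R^n)$, and on functionals by $(P(D)T)(w)=T({}^tP(D)w)$ with ${}^tP(D)=P(-D)=\sum_\alpha(-1)^{|\alpha|}c_\alpha D^\alpha$. Let $H_n=\{x\in\mathbb R^n:x_n\ge0\}$. $P(D)$ is an *evolution operator with respect to $H_n$* if there is a basic $E\in\mathcal L(\mathcal G_c(\mathbb R^n),\widetilde{\mathbb C})$ with $P(D)E=\iota_d(\delta)$, where $\iota_d(\delta)(w)=[(w_\varepsilon(0))_\varepsilon]$, and $\mathrm{supp}\,E\subseteq H_n$. **Theorem.** Let $P(D)$ be an evolution operator with respect to $H_n$. (i) If $v\in\mathcal G_c(\mathbb R^n)$, then the equation $P(D)u=v$ has a solution $u\in\mathcal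 G(\mathbb R^n)$ with $$\mathrm{supp}\,u\subseteq\{x\in\mathbb R^n:\ x_n\ge\inf\{y_n:\ y\in\mathrm{supp}\,v\}\}\qquad(\inf\emptyset=+\infty).$$ (ii) If $v\in\mathcal L(\mathcal G(\mathbb R^n),\widetilde{\mathbb C})$, then $P(D)u=v$ has a solution $u\in\mathcal L(\mathcal G_c(\mathbb R^n),\widetilde{\mathbb C})$ with the same inclusion of supports. (iii) If $v\in\mathcal L(\mathcal G_c(\mathbb R^n),\widetilde{\mathbb C})$ has support contained in a closed cone $\Gamma\subseteq H_n$ with $\Gamma\cap\{x:x_n=0\}=\{0\}$, then $P(D)u=v$ has a solution $u\in\mathcal L(\mathcal G_c(\mathbb R^n),\widetilde{\mathbb C})$ with $\mathrm{supp}\,u\subseteq H_n$. -/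

import Mathlib

open Filter Topology Asymptotics TopologicalSpace
open scoped ContDiff Distributions ENNReal

noncomputable section

namespace Colombeau

/-! ### Nets indexed by `ε ∈ (0,1]` and their growth as `ε → 0` -/

/-- The index set `(0,1]`. -/
abbrev Idx : Type := Set.Ioc (0 : ℝ) 1

/-- The filter `ε → 0` on `(0,1]`. -/
def epsZero : Filter Idx := comap Subtype.val (𝓝 0)

/-- `q_ε = O(ε^b)` as `ε → 0`. -/
def IsOPow (q : Idx → ℝ) (b : ℝ) : Prop :=
  q =O[epsZero] fun ε => (ε : ℝ) ^ b

/-- `q_ε = O(ε^{-N})` for some `N ∈ ℕ`. -/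
def Moderate (q : Idx → ℝ) : Prop := ∃ N : ℕ, IsOPow q (-(N : ℝ))

/-- `q_ε = O(ε^m)` for all `m ∈ ℕ`. -/
def Negligible (q : Idx → ℝ) : Prop := ∀ m : ℕ, IsOPow q (m : ℝ)

/-- The valuation `sup {b ∈ ℝ : q_ε = O(ε^b)}`. -/
def netVal (q : Idx → ℝ) : EReal := sSup ((fun b : ℝ => (b : EReal)) '' {b | IsOPow q b})

lemma IsOPow.anti {q : Idx → ℝ} {b b' : ℝ} (h : IsOPow q b) (hb : b' ≤ b) : IsOPow q b' := by
  refine h.trans (IsBigO.of_bound 1 (Eventually.of_forall fun ε => ?_))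
  rw [Real.norm_of_nonneg (Real.rpow_nonneg ε.2.1.le _),
    Real.norm_of_nonneg (Real.rpow_nonneg ε.2.1.le _), one_mul]
  exact Real.rpow_le_rpow_of_exponent_ge ε.2.1 ε.2.2 hb

lemma IsOPow.mono {q q' : Idx → ℝ} {b : ℝ} (h : IsOPow q' b) (hq : ∀ ε, |q ε| ≤ |q' ε|) :
    IsOPow q b :=
  (IsBigO.of_bound 1 (Eventually.of_forall fun ε => by
    simpa [Real.norm_eq_abs] using hq ε)).trans h

lemma IsOPow.add {q q' : Idx → ℝ} {b : ℝ} (h : IsOPow q b) (h' : IsOPow q' b) :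
    IsOPow (fun ε => q ε + q' ε) b := IsBigO.add h h'

lemma IsOPow.mul {q q' : Idx → ℝ} {b b' : ℝ} (h : IsOPow q b) (h' : IsOPow q' b') :
    IsOPow (fun ε => q ε * q' ε) (b + b') := by
  refine (IsBigO.mul h h').congr_right fun ε => ?_
  rw [Real.rpow_add ε.2.1]

lemma IsOPow.const_mul {q : Idx → ℝ} {b : ℝ} (h : IsOPow q b) (c : ℝ) :
    IsOPow (fun ε => c * q ε) b := IsBigO.const_mul_left h c

lemma isOPow_zero (b : ℝ) : IsOPow (fun _ => 0) b := isBigO_zero _ _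

lemma isOPow_const (c : ℝ) : IsOPow (fun _ => c) 0 := by
  simpa [IsOPow] using isBigO_const_const c (one_ne_zero (α := ℝ)) epsZero

lemma Moderate.mono {q q' : Idx → ℝ} (h : Moderate q') (hq : ∀ ε, |q ε| ≤ |q' ε|) :
    Moderate q := h.imp fun _ hN => hN.mono hq

lemma Moderate.add {q q' : Idx → ℝ} (h : Moderate q) (h' : Moderate q') :
    Moderate fun ε => q ε + q' ε := by
  obtain ⟨N, hN⟩ := h
  obtain ⟨N', hN'⟩ := h'
  exact ⟨N + N', (hN.anti (by push_cast; linarith [N'.cast_nonneg (α := ℝ)])).add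
    (hN'.anti (by push_cast; linarith [N.cast_nonneg (α := ℝ)]))⟩

lemma Moderate.mul {q q' : Idx → ℝ} (h : Moderate q) (h' : Moderate q') :
    Moderate fun ε => q ε * q' ε := by
  obtain ⟨N, hN⟩ := h
  obtain ⟨N', hN'⟩ := h'
  refine ⟨N + N', ?_⟩
  have := hN.mul hN'
  rwa [show (-((N + N' : ℕ) : ℝ)) = -(N : ℝ) + -(N' : ℝ) by push_cast; ring]

lemma moderate_const (c : ℝ) : Moderate fun _ => c := ⟨0, by simpa using isOPow_const c⟩

lemma Negligible.mono {q q' : Idx → ℝ} (h : Negligible q') (hq : ∀ ε, |q ε| ≤ |q' ε|) :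
    Negligible q := fun m => (h m).mono hq

lemma Negligible.add {q q' : Idx → ℝ} (h : Negligible q) (h' : Negligible q') :
    Negligible fun ε => q ε + q' ε := fun m => (h m).add (h' m)

lemma negligible_zero : Negligible fun _ => 0 := fun m => isOPow_zero m

lemma Moderate.mul_negligible {q q' : Idx → ℝ} (h : Moderate q) (h' : Negligible q') :
    Negligible fun ε => q ε * q' ε := by
  obtain ⟨N, hN⟩ := h
  intro m
  have := hN.mul (h' (m + N))
  rwa [show (-(N : ℝ)) + ((m + N : ℕ) : ℝ) = m by push_cast; ring] at this

lemma Negligible.isOPow {q : Idx → ℝ} (h : Negligible q) (b : ℝ) : IsOPow q b := by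
  obtain ⟨m, hm⟩ := exists_nat_ge b
  exact (h m).anti hm

lemma netVal_le_of_imp {q q' : Idx → ℝ} (h : ∀ b, IsOPow q b → IsOPow q' b) :
    netVal q ≤ netVal q' := sSup_le_sSup (Set.image_mono h)

/-- Nets which differ by a negligible net have the same valuation. -/
lemma netVal_congr {q q' r : Idx → ℝ} (hr : Negligible r)
    (h : ∀ ε, |q ε - q' ε| ≤ |r ε|) : netVal q = netVal q' := by
  apply le_antisymm
  · refine netVal_le_of_imp fun b hb => ?_
    have := hb.add (((hr.mono h).isOPow b).const_mul (-1))
    refine this.mono fun ε => le_of_eq ?_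
    congr 1; ring
  · refine netVal_le_of_imp fun b hb => ?_
    have := hb.add ((hr.mono h).isOPow b)
    refine this.mono fun ε => le_of_eq ?_
    congr 1; ring

lemma netVal_zero : netVal (fun _ => 0) = ⊤ := by
  refine EReal.eq_top_iff_forall_lt _ |>.2 fun y => ?_
  refine lt_of_lt_of_le (EReal.coe_lt_coe_iff.2 (lt_add_one y)) (le_sSup ?_)
  exact ⟨y + 1, isOPow_zero _, rfl⟩

lemma min_netVal_le {q q' r : Idx → ℝ} (h : ∀ ε, |r ε| ≤ |q ε| + |q' ε|) :
    min (netVal q) (netVal q') ≤ netVal r := by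
  refine le_of_forall_lt fun c hc => ?_
  rw [lt_min_iff] at hc
  obtain ⟨_, ⟨b, hb, rfl⟩, hcb⟩ := lt_sSup_iff.1 hc.1
  obtain ⟨_, ⟨b', hb', rfl⟩, hcb'⟩ := lt_sSup_iff.1 hc.2
  have h1 : IsOPow (fun ε => |q ε|) (min b b') :=
    IsOPow.mono (hb.anti (min_le_left _ _)) (by simp)
  have h2 : IsOPow (fun ε => |q' ε|) (min b b') :=
    IsOPow.mono (hb'.anti (min_le_right _ _)) (by simp)
  have h3 : IsOPow r (min b b') := (h1.add h2).mono fun ε => (h ε).trans (le_abs_self _)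
  refine lt_of_lt_of_le ?_ (le_sSup ⟨_, h3, rfl⟩)
  rcases min_choice b b' with e | e <;> simpa only [e]

/-! ### The ring of complex generalized numbers -/

/-- Moderate nets of complex numbers. -/
def modNum : Subring (Idx → ℂ) where
  carrier := {a | Moderate fun ε => ‖a ε‖}
  mul_mem' {a b} ha hb := (Moderate.mul ha hb).mono fun ε => by simp
  one_mem' := by simpa using moderate_const 1
  add_mem' {a b} ha hb := (Moderate.add ha hb).mono fun ε => by
    rw [abs_norm, abs_of_nonneg (by positivity)]; exact norm_add_le _ _
  zero_mem' := by simpa using moderate_const 0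
  neg_mem' {a} ha := by simpa using ha

/-- Negligible nets of complex numbers. -/
def negNum : Ideal modNum where
  carrier := {a | Negligible fun ε => ‖a.1 ε‖}
  add_mem' {a b} ha hb := (Negligible.add ha hb).mono fun ε => by
    rw [abs_norm, abs_of_nonneg (by positivity)]; exact norm_add_le _ _
  zero_mem' := by simpa using negligible_zero
  smul_mem' c a ha := (Moderate.mul_negligible c.2 ha).mono fun ε => by simp

/-- The ring of complex generalized numbers. -/
def GenNum : Type := modNum ⧸ negNum

instance : CommRing GenNum := inferInstanceAs (CommRing (modNum ⧸ negNum))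

/-- The class `[(a_ε)_ε]`. -/
def GenNum.mk : modNum →+* GenNum := Ideal.Quotient.mk negNum

lemma GenNum.mk_surjective : Function.Surjective GenNum.mk := Ideal.Quotient.mk_surjective

lemma GenNum.mk_eq {a b : modNum} : GenNum.mk a = GenNum.mk b ↔ a - b ∈ negNum :=
  Ideal.Quotient.eq

/-- Constant nets. -/
def GenNum.const : ℂ →+* GenNum :=
  GenNum.mk.comp
    { toFun := fun c => ⟨fun _ => c, moderate_const ‖c‖⟩
      map_one' := rfl
      map_mul' := fun _ _ => rfl
      map_zero' := rfl
      map_add' := fun _ _ => rfl }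

/-- The valuation on generalized numbers. -/
def GenNum.val (x : GenNum) : EReal :=
  Quotient.liftOn' x (fun a : modNum => netVal fun ε => ‖a.1 ε‖) fun a b hab => by
    have h : a - b ∈ negNum := (Submodule.quotientRel_def _).1 hab
    exact netVal_congr h fun ε => by
      rw [abs_norm]; exact abs_norm_sub_norm_le _ _

lemma GenNum.val_mk (a : modNum) : (GenNum.mk a).val = netVal fun ε => ‖a.1 ε‖ := rfl

/-- The ultra-pseudo-norm `|x|_e = e^{-val x}`. -/
def GenNum.absE (x : GenNum) : ℝ≥0∞ := EReal.exp (-x.val)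

/-- The ultra-pseudo-metric `|x - y|_e`, which gives the topology of the generalized numbers. -/
instance : PseudoEMetricSpace GenNum where
  edist x y := (x - y).absE
  edist_self x := by
    have : (0 : GenNum).val = ⊤ := by
      rw [← map_zero GenNum.mk, GenNum.val_mk]
      simpa using netVal_zero
    simp [GenNum.absE, this]
  edist_comm x y := by
    obtain ⟨a, rfl⟩ := GenNum.mk_surjective x
    obtain ⟨b, rfl⟩ := GenNum.mk_surjective y
    simp only [GenNum.absE, ← map_sub, GenNum.val_mk]
    simp [norm_sub_rev]
  edist_triangle x y z := by
    obtain ⟨a, rfl⟩ := GenNum.mk_surjective x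
    obtain ⟨b, rfl⟩ := GenNum.mk_surjective y
    obtain ⟨c, rfl⟩ := GenNum.mk_surjective z
    simp only [GenNum.absE, ← map_sub, GenNum.val_mk]
    have h := min_netVal_le (q := fun ε => ‖(a - b).1 ε‖) (q' := fun ε => ‖(b - c).1 ε‖)
      (r := fun ε => ‖(a - c).1 ε‖) fun ε => by
        simpa using norm_sub_le_norm_sub_add_norm_sub (a.1 ε) (b.1 ε) (c.1 ε)
    rcases min_le_iff.1 h with h | h
    · exact (EReal.exp_le_exp_iff.2 (EReal.neg_le_neg_iff.2 h)).trans le_self_add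
    · exact (EReal.exp_le_exp_iff.2 (EReal.neg_le_neg_iff.2 h)).trans le_add_self

/-! ### Generalized functions based on a locally convex space -/

section GE

variable {E F ι κ : Type*} [AddCommGroup E] [Module ℂ E] [AddCommGroup F] [Module ℂ F]

/-- Moderate nets of a space topologized by the seminorms `p i`. -/
def modNets (p : ι → Seminorm ℂ E) : Submodule modNum (Idx → E) where
  carrier := {u | ∀ i, Moderate fun ε => p i (u ε)}
  add_mem' {u v} hu hv i := (Moderate.add (hu i) (hv i)).mono fun ε => by
    rw [abs_of_nonneg (apply_nonneg _ _),
      abs_of_nonneg (add_nonneg (apply_nonneg _ _) (apply_nonneg _ _))]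
    exact map_add_le_add (p i) _ _
  zero_mem' i := by simpa using moderate_const 0
  smul_mem' c u hu i := (Moderate.mul c.2 (hu i)).mono fun ε =>
    le_of_eq (congrArg abs (map_smul_eq_mul (p i) (c.1 ε) (u ε)))

instance modNets.instModule (p : ι → Seminorm ℂ E) : Module modNum (modNets p) :=
  Submodule.module _

instance modNets.instSMul (p : ι → Seminorm ℂ E) : SMul modNum (modNets p) :=
  (modNets.instModule p).toSMul

/-- Negligible nets. -/
def negNets (p : ι → Seminorm ℂ E) : Submodule modNum (modNets p) where
  carrier := {u | ∀ i, Negligible fun ε => p i (u.1 ε)}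
  add_mem' {u v} hu hv i := (Negligible.add (hu i) (hv i)).mono fun ε => by
    rw [abs_of_nonneg (apply_nonneg _ _),
      abs_of_nonneg (add_nonneg (apply_nonneg _ _) (apply_nonneg _ _))]
    exact map_add_le_add (p i) _ _
  zero_mem' i := by simpa using negligible_zero
  smul_mem' c u hu i := (Moderate.mul_negligible c.2 (hu i)).mono fun ε =>
    le_of_eq (congrArg abs (map_smul_eq_mul (p i) (c.1 ε) (u.1 ε)))

/-- Generalized functions based on `E`: moderate nets modulo negligible nets. -/
def GE (p : ι → Seminorm ℂ E) : Type _ := modNets p ⧸ negNets p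

variable (p : ι → Seminorm ℂ E) (q : κ → Seminorm ℂ F)

instance : AddCommGroup (GE p) := inferInstanceAs (AddCommGroup (modNets p ⧸ negNets p))

lemma isTorsion_GE : Module.IsTorsionBySet modNum (modNets p ⧸ negNets p) negNum := by
  intro x a
  obtain ⟨u, rfl⟩ := Submodule.Quotient.mk_surjective _ x
  change Submodule.Quotient.mk (a.1 • u) = 0
  rw [Submodule.Quotient.mk_eq_zero]
  intro i
  obtain ha : Negligible fun ε => ‖a.1.1 ε‖ := a.2
  refine (Moderate.mul_negligible (u.2 i) ha).mono fun ε => le_of_eq (congrArg abs ?_)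
  exact (map_smul_eq_mul (p i) (a.1.1 ε) (u.1 ε)).trans (mul_comm _ _)

/-- `[(a_ε)_ε] • [(u_ε)_ε] = [(a_ε u_ε)_ε]`. -/
instance : Module GenNum (GE p) := (isTorsion_GE p).module

variable {p}

/-- The class `[(u_ε)_ε]`. -/
def GE.mk : modNets p →+ GE p := (negNets p).mkQ.toAddMonoidHom

lemma GE.mk_surjective : Function.Surjective (GE.mk (p := p)) :=
  Submodule.Quotient.mk_surjective _

lemma GE.mk_eq {u v : modNets p} : GE.mk u = GE.mk v ↔ u - v ∈ negNets p :=
  Submodule.Quotient.eq _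

lemma GE.mk_smul (a : modNum) (u : modNets p) :
    GE.mk (a • u) = GenNum.mk a • GE.mk u := rfl

/-- The valuation `val_{p_i}`. -/
def GE.val (i : ι) (u : GE p) : EReal :=
  Quotient.liftOn' u (fun f : modNets p => netVal fun ε => p i (f.1 ε)) fun f g hfg => by
    have h : f - g ∈ negNets p := (Submodule.quotientRel_def _).1 hfg
    refine netVal_congr (h i) fun ε => ?_
    rw [abs_of_nonneg (apply_nonneg (p i) _)]
    exact abs_sub_map_le_sub (p i) _ _

lemma GE.val_mk (i : ι) (f : modNets p) :
    (GE.mk f).val i = netVal fun ε => p i (f.1 ε) := rfl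

/-- The ultra-pseudo-seminorm `𝒫_i(u) = e^{-val_{p_i}(u)}`. -/
def GE.ups (i : ι) (u : GE p) : ℝ≥0∞ := EReal.exp (-u.val i)

variable (p)

/-- The ultra-pseudo-metric `𝒫_i(u - v)`. -/
@[reducible] def GE.pseudoEMetric (i : ι) : PseudoEMetricSpace (GE p) where
  edist x y := (x - y).ups i
  edist_self x := by
    have : (0 : GE p).val i = ⊤ := by
      rw [← map_zero (GE.mk (p := p)), GE.val_mk]
      simpa using netVal_zero
    simp [GE.ups, this]
  edist_comm x y := by
    obtain ⟨a, rfl⟩ := GE.mk_surjective x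
    obtain ⟨b, rfl⟩ := GE.mk_surjective y
    simp only [GE.ups, ← map_sub, GE.val_mk]
    simp [map_sub_rev]
  edist_triangle x y z := by
    obtain ⟨a, rfl⟩ := GE.mk_surjective x
    obtain ⟨b, rfl⟩ := GE.mk_surjective y
    obtain ⟨c, rfl⟩ := GE.mk_surjective z
    simp only [GE.ups, ← map_sub, GE.val_mk]
    have h := min_netVal_le (q := fun ε => p i ((a - b).1 ε)) (q' := fun ε => p i ((b - c).1 ε))
      (r := fun ε => p i ((a - c).1 ε)) fun ε => by
        rw [abs_of_nonneg (apply_nonneg _ _), abs_of_nonneg (apply_nonneg _ _),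
          abs_of_nonneg (apply_nonneg _ _)]
        have := map_add_le_add (p i) ((a - b).1 ε) ((b - c).1 ε)
        simpa using this
    rcases min_le_iff.1 h with h | h
    · exact (EReal.exp_le_exp_iff.2 (EReal.neg_le_neg_iff.2 h)).trans le_self_add
    · exact (EReal.exp_le_exp_iff.2 (EReal.neg_le_neg_iff.2 h)).trans le_add_self

/-- The topology defined by the single ultra-pseudo-seminorm `𝒫_i`. -/
@[reducible] def GE.topOf (i : ι) : TopologicalSpace (GE p) :=
  (GE.pseudoEMetric p i).toUniformSpace.toTopologicalSpace

/-- The topology defined by the family of all ultra-pseudo-seminorms `𝒫_i`. -/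
instance : TopologicalSpace (GE p) := ⨅ i, GE.topOf p i

variable {p q}

/-- A linear map `A`, continuous for the seminorms, acts on classes by
`[(u_ε)_ε] ↦ [(A u_ε)_ε]`. -/
def GE.map (A : E →ₗ[ℂ] F) (hA : ∀ j, ∃ i, ∃ C : ℝ, ∀ x, q j (A x) ≤ C * p i x) :
    GE p →ₗ[GenNum] GE q where
  toFun u := Quotient.liftOn' u
    (fun f : modNets p => GE.mk (p := q) ⟨fun ε => A (f.1 ε), fun j => by
      obtain ⟨i, C, hC⟩ := hA j
      refine (Moderate.mul (moderate_const C) (f.2 i)).mono fun ε => ?_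
      rw [abs_of_nonneg (apply_nonneg _ _)]
      exact (hC _).trans (le_abs_self _)⟩)
    (fun f g hfg => by
      have h : f - g ∈ negNets p := (Submodule.quotientRel_def _).1 hfg
      refine GE.mk_eq.2 fun j => ?_
      obtain ⟨i, C, hC⟩ := hA j
      refine (Moderate.mul_negligible (moderate_const C) (h i)).mono fun ε => ?_
      rw [abs_of_nonneg (apply_nonneg _ _)]
      refine (le_of_eq ?_).trans ((hC _).trans (le_abs_self _))
      exact congrArg (q j) (map_sub A (f.1 ε) (g.1 ε)).symm)
  map_add' u v := by
    obtain ⟨f, rfl⟩ := GE.mk_surjective u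
    obtain ⟨g, rfl⟩ := GE.mk_surjective v
    refine congrArg (GE.mk (p := q)) (Subtype.ext (funext fun ε => ?_))
    exact map_add A (f.1 ε) (g.1 ε)
  map_smul' c u := by
    obtain ⟨a, rfl⟩ := GenNum.mk_surjective c
    obtain ⟨f, rfl⟩ := GE.mk_surjective u
    refine congrArg (GE.mk (p := q)) (Subtype.ext (funext fun ε => ?_))
    exact map_smul A (a.1 ε) (f.1 ε)

/-- A linear form `A`, continuous for the seminorms, acts on classes by
`[(u_ε)_ε] ↦ [(A u_ε)_ε]`. -/
def GE.form (A : E →ₗ[ℂ] ℂ) (hA : ∃ i, ∃ C : ℝ, ∀ x, ‖A x‖ ≤ C * p i x) :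
    GE p →ₗ[GenNum] GenNum where
  toFun u := Quotient.liftOn' u
    (fun f : modNets p => GenNum.mk ⟨fun ε => A (f.1 ε), by
      obtain ⟨i, C, hC⟩ := hA
      refine (Moderate.mul (moderate_const C) (f.2 i)).mono fun ε => ?_
      rw [abs_norm]
      exact (hC _).trans (le_abs_self _)⟩)
    (fun f g hfg => by
      have h : f - g ∈ negNets p := (Submodule.quotientRel_def _).1 hfg
      refine GenNum.mk_eq.2 ?_
      obtain ⟨i, C, hC⟩ := hA
      refine (Moderate.mul_negligible (moderate_const C) (h i)).mono fun ε => ?_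
      rw [abs_norm]
      refine (le_of_eq ?_).trans ((hC _).trans (le_abs_self _))
      exact congrArg norm (map_sub A (f.1 ε) (g.1 ε)).symm)
  map_add' u v := by
    obtain ⟨f, rfl⟩ := GE.mk_surjective u
    obtain ⟨g, rfl⟩ := GE.mk_surjective v
    refine congrArg GenNum.mk (Subtype.ext (funext fun ε => ?_))
    exact map_add A (f.1 ε) (g.1 ε)
  map_smul' c u := by
    obtain ⟨a, rfl⟩ := GenNum.mk_surjective c
    obtain ⟨f, rfl⟩ := GE.mk_surjective u
    refine congrArg GenNum.mk (Subtype.ext (funext fun ε => ?_))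
    exact map_smul A (a.1 ε) (f.1 ε)

end GE

/-! ### Smooth functions on `ℝ^d` and their seminorms -/

/-- `ℝ^d`. -/
abbrev Rn (d : ℕ) : Type := EuclideanSpace ℝ (Fin d)

/-- Complex-valued smooth functions on `ℝ^d`. -/
def Smooth (d : ℕ) : Submodule ℂ (Rn d → ℂ) where
  carrier := {f | ContDiff ℝ ∞ f}
  add_mem' {f g} hf hg := by
    have hf : ContDiff ℝ ∞ f := hf
    have hg : ContDiff ℝ ∞ g := hg
    exact hf.add hg
  zero_mem' := by
    change ContDiff ℝ ∞ fun _ => (0 : ℂ)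
    exact contDiff_const
  smul_mem' c f hf := by
    have hf : ContDiff ℝ ∞ f := hf
    exact hf.const_smul c

lemma Smooth.contDiff {d : ℕ} (f : Smooth d) : ContDiff ℝ ∞ f.1 := f.2

variable {d : ℕ}

/-- The partial derivative `∂_j`. -/
def pd (j : Fin d) : Module.End ℂ (Smooth d) where
  toFun f := ⟨fun x => fderiv ℝ f.1 x (EuclideanSpace.single j 1),
    (ContDiff.fderiv_right (m := ∞) (n := ∞) (Smooth.contDiff f) (by simp)).clm_apply contDiff_const⟩
  map_add' f g := Subtype.ext <| funext fun x => by
    have hf : DifferentiableAt ℝ f.1 x := (Smooth.contDiff f).differentiable (by simp) x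
    have hg : DifferentiableAt ℝ g.1 x := (Smooth.contDiff g).differentiable (by simp) x
    change fderiv ℝ (f.1 + g.1) x _ = _
    rw [fderiv_add hf hg]; rfl
  map_smul' c f := Subtype.ext <| funext fun x => by
    have hf : DifferentiableAt ℝ f.1 x := (Smooth.contDiff f).differentiable (by simp) x
    change fderiv ℝ (c • f.1) x _ = _
    rw [fderiv_const_smul hf]; rfl

/-- The product `A_0^{α_0} ⋯ A_{d-1}^{α_{d-1}}` of powers of operators. -/
def opPow {M : Type*} [Monoid M] {d : ℕ} (A : Fin d → M) (α : Fin d → ℕ) : M :=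
  (List.ofFn fun j => A j ^ α j).prod

lemma opPow_mul {M : Type*} [Monoid M] {d : ℕ} (A : Fin d → M)
    (hA : ∀ i j, Commute (A i) (A j)) (α : Fin d → ℕ) (j : Fin d) :
    opPow A α * A j = opPow A (α + Pi.single j 1) := by
  induction d with
  | zero => exact j.elim0
  | succ d ih =>
    have key : ∀ β : Fin (d + 1) → ℕ,
        opPow A β = A 0 ^ β 0 * opPow (fun i => A i.succ) (fun i => β i.succ) := fun β => by
      simp [opPow, List.ofFn_succ]
    rw [key, key]
    refine Fin.cases ?_ (fun i => ?_) j
    · have hc : Commute (opPow (fun i => A i.succ) (fun i => α i.succ)) (A 0) := by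
        refine Commute.list_prod_left _ _ fun x hx => ?_
        obtain ⟨i, rfl⟩ := (List.mem_ofFn' _ _).1 hx
        exact (hA _ _).pow_left _
      have e : (fun i : Fin d => (α + Pi.single 0 1 : Fin (d + 1) → ℕ) i.succ) = fun i => α i.succ := by
        funext i; simp
      rw [e, mul_assoc, hc.eq, ← mul_assoc, ← pow_succ]
      simp
    · have e : (fun k : Fin d => (α + Pi.single i.succ 1 : Fin (d + 1) → ℕ) k.succ)
          = (fun k => α k.succ) + Pi.single i 1 := by
        funext k
        by_cases h : k = i
        · subst h; simp
        · simp [h]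
      rw [e, mul_assoc, ih _ (fun _ _ => hA _ _)]
      simp

lemma pd_commute (i j : Fin d) : Commute (pd i) (pd j) := by
  refine LinearMap.ext fun f => Subtype.ext <| funext fun x => ?_
  have hf : ContDiff ℝ ∞ f.1 := f.2
  have h1 : DifferentiableAt ℝ (fderiv ℝ f.1) x :=
    ((hf.fderiv_right (m := ∞) (by simp)).differentiable (by simp)) x
  have key : ∀ a b : Rn d, fderiv ℝ (fun y => fderiv ℝ f.1 y b) x a
      = fderiv ℝ (fderiv ℝ f.1) x a b := fun a b => by
    rw [fderiv_clm_apply h1 (differentiableAt_const b)]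
    simp
  change fderiv ℝ (fun y => fderiv ℝ f.1 y _) x _ = fderiv ℝ (fun y => fderiv ℝ f.1 y _) x _
  rw [key, key]
  exact (hf.contDiffAt (x := x)).isSymmSndFDerivAt (by simpa using WithTop.coe_le_coe.2 (le_top : (2 : ℕ∞) ≤ ⊤)) _ _

/-- `f ↦ f|_K` into continuous functions on `K`. -/
def restrictTo (K : Compacts (Rn d)) : Smooth d →ₗ[ℂ] C(K, ℂ) where
  toFun f := ⟨fun x => f.1 x, (Smooth.contDiff f).continuous.comp continuous_subtype_val⟩
  map_add' _ _ := rfl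
  map_smul' _ _ := rfl

/-- The multi-indices `α ∈ ℕ^d` with `|α| ≤ i`. -/
def multiIdx (d i : ℕ) : Finset (Fin d → ℕ) :=
  (Finset.Iic fun _ => i).filter fun α => ∑ j, α j ≤ i

/-- The seminorms `p_{K,i}(f) = sup_{x ∈ K, |α| ≤ i} |∂^α f(x)|`, indexed by pairs `(K, i)`. -/
def pSem (d : ℕ) (k : Compacts (Rn d) × ℕ) : Seminorm ℂ (Smooth d) :=
  (multiIdx d k.2).sup fun α =>
    (normSeminorm ℂ C(k.1, ℂ)).comp (restrictTo k.1 ∘ₗ opPow pd α)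

lemma mem_multiIdx {d i : ℕ} {α : Fin d → ℕ} : α ∈ multiIdx d i ↔ ∑ j, α j ≤ i := by
  simp only [multiIdx, Finset.mem_filter, Finset.mem_Iic, and_iff_right_iff_imp]
  exact fun h j => (Finset.single_le_sum (fun _ _ => Nat.zero_le _) (Finset.mem_univ j)).trans h

lemma le_pSem (k : Compacts (Rn d) × ℕ) {α : Fin d → ℕ} (hα : ∑ j, α j ≤ k.2)
    (f : Smooth d) {x : Rn d} (hx : x ∈ k.1) : ‖(opPow pd α f).1 x‖ ≤ pSem d k f := by
  have h1 : ((normSeminorm ℂ C(k.1, ℂ)).comp (restrictTo k.1 ∘ₗ opPow pd α)) f ≤ pSem d k f :=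
    Seminorm.le_finset_sup_apply (p := fun α =>
      (normSeminorm ℂ C(k.1, ℂ)).comp (restrictTo k.1 ∘ₗ opPow pd α)) (mem_multiIdx.2 hα)
  exact (ContinuousMap.norm_coe_le_norm (restrictTo k.1 (opPow pd α f)) ⟨x, hx⟩).trans h1

lemma pSem_le (k : Compacts (Rn d) × ℕ) (f : Smooth d) {C : ℝ} (hC : 0 ≤ C)
    (h : ∀ α : Fin d → ℕ, ∑ j, α j ≤ k.2 → ∀ x ∈ k.1, ‖(opPow pd α f).1 x‖ ≤ C) :
    pSem d k f ≤ C := by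
  refine Seminorm.finset_sup_apply_le hC fun α hα => ?_
  refine (ContinuousMap.norm_le (restrictTo k.1 (opPow pd α f)) hC).2 fun x => ?_
  exact h α (mem_multiIdx.1 hα) x.1 x.2

lemma pSem_pd (K : Compacts (Rn d)) (i : ℕ) (j : Fin d) (f : Smooth d) :
    pSem d (K, i) (pd j f) ≤ pSem d (K, i + 1) f := by
  refine pSem_le _ _ (apply_nonneg _ _) fun α hα x hx => ?_
  have := le_pSem (K, i + 1) (α := α + Pi.single j 1)
    (by simpa [Finset.sum_add_distrib] using hα) f hx
  rwa [← opPow_mul pd pd_commute] at this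

/-! ### The Colombeau algebra, supports, differentiation -/

/-- The Colombeau algebra on `ℝ^d`, as a module over the generalized numbers. -/
abbrev G (d : ℕ) : Type := GE (pSem d)

/-- `u|_V = 0`: some (equivalently, every) representative of `u` is negligible on `V`. -/
def VanishesOn (u : G d) (V : Set (Rn d)) : Prop :=
  ∃ f : modNets (pSem d), GE.mk f = u ∧
    ∀ K : Compacts (Rn d), (K : Set (Rn d)) ⊆ V → ∀ i, Negligible fun ε => pSem d (K, i) (f.1 ε)

/-- The support of a generalized function: the points with no open neighbourhood on which it
vanishes. -/
def supp (u : G d) : Set (Rn d) := {x | ∀ V : Set (Rn d), IsOpen V → x ∈ V → ¬ VanishesOn u V}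

lemma isClosed_supp (u : G d) : IsClosed (supp u) := by
  rw [← isOpen_compl_iff, isOpen_iff_forall_mem_open]
  intro x hx
  simp only [supp, Set.mem_compl_iff, Set.mem_ofPred_eq, not_forall, not_not] at hx
  obtain ⟨V, hV, hxV, hu⟩ := hx
  exact ⟨V, fun y hy h => h V hV hy hu, hV, hxV⟩

lemma supp_zero : supp (0 : G d) = ∅ := by
  refine Set.eq_empty_iff_forall_notMem.2 fun x hx => hx Set.univ isOpen_univ trivial ?_
  exact ⟨0, map_zero _, fun K _ i => by simpa using negligible_zero⟩

lemma supp_add (u v : G d) : supp (u + v) ⊆ supp u ∪ supp v := by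
  intro x hx
  by_contra h
  simp only [Set.mem_union, not_or, supp, Set.mem_ofPred_eq, not_forall, not_not] at h
  obtain ⟨⟨V, hV, hxV, f, rfl, hf⟩, W, hW, hxW, g, rfl, hg⟩ := h
  refine hx (V ∩ W) (hV.inter hW) ⟨hxV, hxW⟩ ⟨f + g, map_add _ _ _, fun K hK i => ?_⟩
  refine (Negligible.add (hf K (fun y hy => (hK hy).1) i)
    (hg K (fun y hy => (hK hy).2) i)).mono fun ε => ?_
  rw [abs_of_nonneg (apply_nonneg _ _),
    abs_of_nonneg (add_nonneg (apply_nonneg _ _) (apply_nonneg _ _))]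
  exact map_add_le_add (pSem d (K, i)) _ _

lemma supp_smul (c : GenNum) (u : G d) : supp (c • u) ⊆ supp u := by
  intro x hx V hV hxV hu
  obtain ⟨a, rfl⟩ := GenNum.mk_surjective c
  obtain ⟨f, rfl, hf⟩ := hu
  refine hx V hV hxV ⟨a • f, GE.mk_smul a f, fun K hK i => ?_⟩
  exact (Moderate.mul_negligible a.2 (hf K hK i)).mono fun ε =>
    le_of_eq (congrArg abs (map_smul_eq_mul (pSem d (K, i)) (a.1 ε) (f.1 ε)))

/-- `∂_j` on the Colombeau algebra. -/
def pdG (j : Fin d) : Module.End GenNum (G d) :=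
  GE.map (pd j) fun k => ⟨(k.1, k.2 + 1), 1, fun f => by
    rw [one_mul]; exact pSem_pd k.1 k.2 j f⟩

lemma supp_pdG (j : Fin d) (u : G d) : supp (pdG j u) ⊆ supp u := by
  intro x hx V hV hxV hu
  obtain ⟨f, rfl, hf⟩ := hu
  refine hx V hV hxV ⟨_, rfl, fun K hK i => (hf K hK (i + 1)).mono fun ε => ?_⟩
  rw [abs_of_nonneg (apply_nonneg _ _), abs_of_nonneg (apply_nonneg _ _)]
  exact pSem_pd K i j (f.1 ε)

/-- The submodule of generalized functions with compact support. -/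
def cptSupp (d : ℕ) : Submodule GenNum (G d) where
  carrier := {u | IsCompact (supp u)}
  add_mem' {u v} hu hv :=
    (IsCompact.union hu hv).of_isClosed_subset (isClosed_supp _) (supp_add u v)
  zero_mem' := by
    change IsCompact (supp 0)
    rw [supp_zero]; exact isCompact_empty
  smul_mem' c u hu := IsCompact.of_isClosed_subset hu (isClosed_supp _) (supp_smul c u)

/-- Generalized functions with compact support. This is a new type because its topology is not
the subspace topology. -/
def Gc (d : ℕ) : Type := cptSupp d

instance : AddCommGroup (Gc d) := inferInstanceAs (AddCommGroup (cptSupp d))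

instance : Module GenNum (Gc d) := inferInstanceAs (Module GenNum (cptSupp d))

/-- The inclusion of the compactly supported generalized functions in the Colombeau algebra. -/
def incl (d : ℕ) : Gc d →ₗ[GenNum] G d := (cptSupp d).subtype

/-- `∂_j` on compactly supported generalized functions. -/
def pdGc (j : Fin d) : Module.End GenNum (Gc d) :=
  LinearMap.restrict (p := cptSupp d) (q := cptSupp d) (pdG j) fun u hu =>
    IsCompact.of_isClosed_subset hu (isClosed_supp _) (supp_pdG j u)

/-! ### The inductive limit topology and the duals -/

/-- The compactly supported generalized functions with support in `K`. -/
def GK (K : Compacts (Rn d)) : Type := {w : Gc d // supp (incl d w) ⊆ K}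

/-- The topology on `GK K` given by the ultra-pseudo-seminorms `e^{-val_{K',i}}` where `K'` is
a compact set containing `K` in its interior. -/
instance (K : Compacts (Rn d)) : TopologicalSpace (GK K) :=
  ⨅ k : {k : Compacts (Rn d) × ℕ // (K : Set (Rn d)) ⊆ interior (k.1 : Set (Rn d))},
    TopologicalSpace.induced (fun w : GK K => incl d w.1) (GE.topOf (pSem d) k.1)

/-- `M` is a topological module over the generalized numbers in which `0` has a base of
neighbourhoods `A` with `A + A ⊆ A`. -/
structure IsLocallyConvexModule (M : Type*) [AddCommGroup M] [Module GenNum M]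
    [TopologicalSpace M] : Prop where
  addGroup : IsTopologicalAddGroup M
  smul : ContinuousSMul GenNum M
  convex : ∀ U ∈ 𝓝 (0 : M), ∃ A ∈ 𝓝 (0 : M), A ⊆ U ∧ ∀ x ∈ A, ∀ y ∈ A, x + y ∈ A

/-- The inductive limit topology: the finest locally convex module topology for which all the
inclusions `GK K → Gc` are continuous. -/
instance : TopologicalSpace (Gc d) :=
  sInf {t : TopologicalSpace (Gc d) | @IsLocallyConvexModule (Gc d) _ _ t ∧
    ∀ K : Compacts (Rn d), @Continuous (GK K) (Gc d) _ t Subtype.val}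

/-- The dual `L(G_c, ℂ~)`. -/
abbrev DualGc (d : ℕ) : Type := Gc d →L[GenNum] GenNum

/-- The dual `L(G, ℂ~)`. -/
abbrev DualG (d : ℕ) : Type := G d →L[GenNum] GenNum

/-- The support of a functional on compactly supported generalized functions: the points with no
open neighbourhood `V` such that the functional vanishes on all `w` with support in `V`. -/
def dsupp (T : Gc d →ₗ[GenNum] GenNum) : Set (Rn d) :=
  {x | ∀ V : Set (Rn d), IsOpen V → x ∈ V → ∃ w : Gc d, supp (incl d w) ⊆ V ∧ T w ≠ 0}

/-- A functional on the Colombeau algebra regarded as a functional on compactly supported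
generalized functions. -/
def DualG.res (T : DualG d) : Gc d →ₗ[GenNum] GenNum := T.toLinearMap ∘ₗ incl d

/-- `ι_d(δ) : w = [(w_ε)_ε] ↦ [(w_ε(0))_ε]`. -/
def delta (d : ℕ) : Gc d →ₗ[GenNum] GenNum :=
  GE.form (p := pSem d) ((LinearMap.proj (0 : Rn d)) ∘ₗ (Smooth d).subtype)
    ⟨(⟨{0}, isCompact_singleton⟩, 0), 1, fun f => by
      have := le_pSem (d := d) (⟨{0}, isCompact_singleton⟩, 0) (α := 0) (by simp) f
        (x := 0) rfl
      have h0 : opPow (pd (d := d)) 0 = 1 := by simp [opPow]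
      rw [h0] at this
      simpa using this⟩ ∘ₗ incl d

/-! ### Basic functionals -/

/-- A test function regarded as a smooth function. -/
def ofTest (f : 𝓓((⊤ : Opens (Rn d)), ℂ)) : Smooth d := ⟨f, f.contDiff⟩

/-- `T` is basic: it is given by a net `(T_ε)_ε` of distributions such that for all compact `K`
one has `|T_ε(f)| ≤ c ε^{-N} p_{K,j}(f)` for `f` supported in `K` and `ε` small, through
`T [(f_ε)_ε] = [(T_ε f_ε)_ε]` where the `f_ε` are supported in a common compact set. -/
def IsBasic (T : DualGc d) : Prop :=
  ∃ S : Idx → (𝓓((⊤ : Opens (Rn d)), ℂ) →L[ℂ] ℂ),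
    (∀ K : Compacts (Rn d), ∃ j : ℕ, ∃ c > (0 : ℝ), ∃ N : ℕ, ∃ η : Idx,
      ∀ f : 𝓓((⊤ : Opens (Rn d)), ℂ), tsupport f ⊆ K → ∀ ε : Idx, ε ≤ η →
        ‖S ε f‖ ≤ c * (ε : ℝ) ^ (-(N : ℝ)) * pSem d (K, j) (ofTest f)) ∧
    ∀ (K : Compacts (Rn d)) (f : Idx → 𝓓((⊤ : Opens (Rn d)), ℂ)),
      (∀ ε, tsupport (f ε) ⊆ K) →
      ∀ (hf : (fun ε => ofTest (f ε)) ∈ modNets (pSem d)) (w : Gc d),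
        incl d w = GE.mk ⟨_, hf⟩ →
        ∃ h : (fun ε => S ε (f ε)) ∈ modNum, T w = GenNum.mk ⟨_, h⟩

/-! ### Operators with constant generalized coefficients -/

/-- `∑_α c_α A^α` for the polynomial `P = ∑_α c_α ζ^α`. -/
def polyOp {M : Type*} [AddCommGroup M] [Module GenNum M] (A : Fin d → Module.End GenNum M)
    (P : MvPolynomial (Fin d) GenNum) : Module.End GenNum M :=
  ∑ α ∈ P.support, P.coeff α • opPow A α

/-- `P(D)` on the Colombeau algebra, where `D_j = -i ∂_j`. -/
def opG (P : MvPolynomial (Fin d) GenNum) : Module.End GenNum (G d) :=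
  polyOp (fun j => GenNum.const (-Complex.I) • pdG j) P

/-- The transpose `ᵗP(D) = P(-D)` on compactly supported generalized functions. -/
def opTranspose (P : MvPolynomial (Fin d) GenNum) : Module.End GenNum (Gc d) :=
  polyOp (fun j => -(GenNum.const (-Complex.I) • pdGc j)) P

/-- `P(D)` on functionals: `(P(D)T)(w) = T(ᵗP(D)w)`. -/
def opDual (P : MvPolynomial (Fin d) GenNum) (T : Gc d →ₗ[GenNum] GenNum) :
    Gc d →ₗ[GenNum] GenNum :=
  T ∘ₗ opTranspose P

/-- The half space `{x : x_n ≥ 0}`, where `x_n` is the last coordinate. -/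
def halfSpace (m : ℕ) : Set (Rn (m + 1)) := {x | 0 ≤ x (Fin.last m)}

/-- `{x : x_n ≥ inf {y_n : y ∈ S}}`, the infimum being taken in `[-∞,+∞]`. -/
def above {m : ℕ} (S : Set (Rn (m + 1))) : Set (Rn (m + 1)) :=
  {x | (⨅ y ∈ S, ((y (Fin.last m) : ℝ) : EReal)) ≤ ((x (Fin.last m) : ℝ) : EReal)}

/-- `P(D)` has a basic fundamental solution supported in the half space. -/
def IsEvolutionOperator {m : ℕ} (P : MvPolynomial (Fin (m + 1)) GenNum) : Prop :=
  ∃ E : DualGc (m + 1), IsBasic E ∧ opDual P E.toLinearMap = delta (m + 1) ∧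
    dsupp E.toLinearMap ⊆ halfSpace m

end Colombeau

end

open Colombeau

noncomputable section

namespace Colombeau

/-! ### Valuations and topologies -/

/-! Let `E` be the basic fundamental solution, given by distributions `S ε`. The whole proof rests
on one operator, `convG`: it sends `w = [(w_ε)]` to the class of `x ↦ S_ε(w_ε(x + ·))`, the
convolution of `w` with the reflected `E`. Basicness gives estimates that lose only a fixed power of
`ε`, so `convG` is well defined (`ModerateDistr.mk_congr`) and continuous from each `GK K` to `G`
(`continuous_convG`).

It commutes with derivatives and translations, and its value at `0` is `E w`. Hence the value of
`convG (ᵗP(D)w)` at `a_ε` is `E(ᵗP(D)(w(a_ε + ·))) = w(a_ε)`. A family of generalized functions that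
is stable under differentiation vanishes once its values along all nets in compact sets do
(`vanishesOn_of_pointValues`). This gives the inversion formula `convG_opTranspose`: `convG ∘ ᵗP(D)`
is the inclusion of `Gc` in `G`. The same test by point values shows that if `w` lives in `{x_n <
c}`, then `convG w` lives in `{x_n ≤ c}`, because `E` lives in the half space (`supp_convG_subset`).

The three solutions follow. (i) Conjugating `convG` by `y ↦ -y` exchanges `P(-D)` with `P(D)` and
reverses the supports, so `u = reflG (convG (reflGc v))`. (ii) By duality `u = v ∘ convG`; then
`u(ᵗP(D)w) = v(w)`. (iii) Here `v` acts on compactly supported elements only, so `u(w) = v(ψ · convG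
w)`, where `ψ = 1` near `Γ` and `ψ` is supported in a slight enlargement of the cone. Since `convG
w` is bounded above in `x_n` and the enlarged cone meets each `{x_n ≤ c}` in a bounded set, the
product has compact support; the factor `1 - ψ` is invisible to `v`. -/

lemma IsOPow.mono_eventually {q q' : Idx → ℝ} {b : ℝ} (h : IsOPow q' b)
    (hq : ∀ᶠ ε in epsZero, |q ε| ≤ |q' ε|) : IsOPow q b :=
  (IsBigO.of_bound 1 (hq.mono fun ε hε => by simpa [Real.norm_eq_abs] using hε)).trans h

lemma Moderate.mono_eventually {q q' : Idx → ℝ} (h : Moderate q')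
    (hq : ∀ᶠ ε in epsZero, |q ε| ≤ |q' ε|) : Moderate q :=
  h.imp fun _ hN => hN.mono_eventually hq

lemma Negligible.mono_eventually {q q' : Idx → ℝ} (h : Negligible q')
    (hq : ∀ᶠ ε in epsZero, |q ε| ≤ |q' ε|) : Negligible q :=
  fun m => (h m).mono_eventually hq

lemma eventually_le_epsZero (η : Idx) : ∀ᶠ ε in epsZero, ε ≤ η := by
  have : ∀ᶠ x : ℝ in 𝓝 0, x < (η : ℝ) := gt_mem_nhds η.2.1
  exact (tendsto_comap.eventually this).mono fun ε hε => le_of_lt hε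

lemma isOPow_rpow (c b : ℝ) : IsOPow (fun ε : Idx => c * (ε : ℝ) ^ b) b :=
  IsOPow.const_mul (isBigO_refl _ _) c

lemma moderate_rpow (c : ℝ) (N : ℕ) : Moderate fun ε : Idx => c * (ε : ℝ) ^ (-(N : ℝ)) :=
  ⟨N, isOPow_rpow c _⟩

lemma netVal_eq_top {q : Idx → ℝ} (h : netVal q = ⊤) : Negligible q := by
  intro m
  have hm : ((m : ℝ) : EReal) < netVal q := by rw [h]; exact EReal.coe_lt_top _
  obtain ⟨_, ⟨b, hb, rfl⟩, hlt⟩ := lt_sSup_iff.1 hm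
  exact IsOPow.anti hb (EReal.coe_lt_coe_iff.1 hlt).le

lemma netVal_of_negligible {q : Idx → ℝ} (h : Negligible q) : netVal q = ⊤ := by
  rw [netVal_congr (q' := fun _ => 0) h fun ε => by simp]
  exact netVal_zero

/-- An estimate that loses a factor `ε^{-N}` costs `N` in valuation. With `exp_neg_le_of_le_add` it
becomes a Lipschitz bound with constant `e^N`, the source of all continuity statements below. -/
lemma netVal_le_add {q q' : Idx → ℝ} {C N : ℝ}
    (h : ∀ᶠ ε in epsZero, |q' ε| ≤ C * (ε : ℝ) ^ (-N) * |q ε|) :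
    netVal q ≤ netVal q' + (N : EReal) := by
  refine sSup_le ?_
  rintro _ ⟨b, hb, rfl⟩
  have h1 : IsOPow q' (b - N) := by
    have h2 := (isOPow_rpow C (-N)).mul hb
    rw [show -N + b = b - N by ring] at h2
    refine h2.mono_eventually (h.mono fun ε hε => hε.trans ?_)
    rw [abs_mul]
    exact mul_le_mul_of_nonneg_right (le_abs_self _) (abs_nonneg _)
  have h3 : ((b - N : ℝ) : EReal) ≤ netVal q' := le_sSup ⟨_, h1, rfl⟩
  calc ((b : ℝ) : EReal) = ((b - N : ℝ) : EReal) + (N : EReal) := by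
        rw [← EReal.coe_add]; simp
    _ ≤ _ := add_le_add_left h3 _

lemma exp_neg_le_of_le_add {a b : EReal} {N : ℝ} (h : a ≤ b + (N : EReal)) :
    EReal.exp (-b) ≤ ((Real.exp N).toNNReal : ℝ≥0∞) * EReal.exp (-a) := by
  have h1 : ((Real.exp N).toNNReal : ℝ≥0∞) = EReal.exp (N : EReal) := by
    rw [EReal.exp_coe]; rfl
  rw [h1, ← EReal.exp_add, EReal.exp_le_exp_iff]
  -- Infinite valuations (negligible nets) do not allow cancellation and are treated apart.
  induction a with
  | bot => simp
  | top =>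
    induction b with
    | bot => simp at h
    | top => simp
    | coe b => exact absurd h (by rw [← EReal.coe_add]; exact not_le.2 (EReal.coe_lt_top _))
  | coe a =>
    induction b with
    | bot => simp at h
    | top => simp
    | coe b =>
      have : a ≤ b + N := by exact_mod_cast h
      have h2 : -b ≤ N + -a := by linarith
      exact_mod_cast h2

/-! ### The generalized numbers as a separated, locally convex topological ring -/

namespace GenNum

/-- Infinite valuation means negligible, so the pseudo-metric separates points and limits are
unique. -/
lemma eq_zero_of_absE {x : GenNum} (h : x.absE = 0) : x = 0 := by
  obtain ⟨a, rfl⟩ := GenNum.mk_surjective x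
  have h1 : (GenNum.mk a).val = ⊤ := by
    have : -(GenNum.mk a).val = ⊥ := EReal.exp_eq_zero_iff.1 h
    simpa using this
  rw [GenNum.val_mk] at h1
  have h2 := netVal_eq_top h1
  rw [← map_zero GenNum.mk, GenNum.mk_eq, sub_zero]
  exact h2

lemma eq_of_edist {x y : GenNum} (h : edist x y = 0) : x = y :=
  sub_eq_zero.1 (eq_zero_of_absE h)

lemma edist_zero_right (x : GenNum) : edist x 0 = x.absE := by
  change (x - 0).absE = _
  rw [sub_zero]

lemma edist_add_right (x y z : GenNum) : edist (x + z) (y + z) = edist x y := by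
  change (x + z - (y + z)).absE = (x - y).absE
  rw [add_sub_add_right_eq_sub]

lemma edist_add_left (x y z : GenNum) : edist (z + x) (z + y) = edist x y := by
  change (z + x - (z + y)).absE = (x - y).absE
  rw [add_sub_add_left_eq_sub]

lemma edist_neg_neg (x y : GenNum) : edist (-x) (-y) = edist x y := by
  rw [edist_comm x y]
  change (-x - -y).absE = (y - x).absE
  congr 1; ring

lemma absE_mul_le {a : modNum} {N : ℝ} (h : IsOPow (fun ε => ‖a.1 ε‖) (-N)) (y : GenNum) :
    (GenNum.mk a * y).absE ≤ ((Real.exp N).toNNReal : ℝ≥0∞) * y.absE := by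
  obtain ⟨b, rfl⟩ := GenNum.mk_surjective y
  obtain ⟨C, hC⟩ := h.bound
  refine exp_neg_le_of_le_add ?_
  rw [← map_mul, GenNum.val_mk, GenNum.val_mk]
  refine netVal_le_add (C := C) (hC.mono fun ε hε => ?_)
  rw [Real.norm_of_nonneg (norm_nonneg _),
    Real.norm_of_nonneg (Real.rpow_nonneg ε.2.1.le _)] at hε
  rw [abs_norm, abs_norm]
  change ‖a.1 ε * b.1 ε‖ ≤ _
  rw [norm_mul]
  exact mul_le_mul_of_nonneg_right hε (norm_nonneg _)

lemma exists_absE_mul_le (x : GenNum) :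
    ∃ C : NNReal, ∀ y : GenNum, (x * y).absE ≤ C * y.absE := by
  obtain ⟨a, rfl⟩ := GenNum.mk_surjective x
  obtain ⟨N, hN⟩ : Moderate fun ε => ‖a.1 ε‖ := a.2
  exact ⟨_, absE_mul_le hN⟩

/-- Positive valuation makes the net `O(ε^0)`, so the Lipschitz constant is `e^0 = 1`. -/
lemma absE_mul_le_of_lt_one {x : GenNum} (hx : x.absE < 1) (y : GenNum) :
    (x * y).absE ≤ y.absE := by
  obtain ⟨a, rfl⟩ := GenNum.mk_surjective x
  have h1 : (0 : EReal) < (GenNum.mk a).val := by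
    have h2 : EReal.exp (-(GenNum.mk a).val) < EReal.exp 0 := by
      rw [EReal.exp_zero]; exact hx
    rw [EReal.exp_lt_exp_iff] at h2
    simpa using EReal.neg_lt_neg_iff.2 h2
  obtain ⟨_, ⟨b, hb, rfl⟩, hlt⟩ := lt_sSup_iff.1 h1
  have h3 : IsOPow (fun ε => ‖a.1 ε‖) (-0) :=
    IsOPow.anti hb (by rw [neg_zero]; exact (EReal.coe_lt_coe_iff.1 hlt).le)
  simpa using absE_mul_le h3 y

instance : IsUniformAddGroup GenNum where
  uniformContinuous_sub := by
    have : LipschitzWith 2 fun p : GenNum × GenNum => p.1 - p.2 := fun p q => by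
      calc edist (p.1 - p.2) (q.1 - q.2) ≤ edist (p.1 - p.2) (q.1 - p.2)
            + edist (q.1 - p.2) (q.1 - q.2) := edist_triangle _ _ _
        _ = edist p.1 q.1 + edist p.2 q.2 := by
          simp only [sub_eq_add_neg, edist_add_right, edist_add_left, edist_neg_neg]
        _ ≤ edist p q + edist p q :=
          add_le_add (le_max_left _ _) (le_max_right _ _)
        _ = _ := by rw [← two_mul]; rfl
    exact this.uniformContinuous

lemma tendsto_mul_left_zero (x : GenNum) : Tendsto (fun y => x * y) (𝓝 0) (𝓝 0) := by
  obtain ⟨C, hC⟩ := exists_absE_mul_le x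
  have : LipschitzWith C fun y => x * y := fun y z => by
    change (x * y - x * z).absE ≤ _
    rw [← mul_sub]
    exact hC _
  simpa using this.continuous.tendsto 0

instance : IsTopologicalRing GenNum := by
  refine IsTopologicalRing.of_addGroup_of_nhds_zero ?_ tendsto_mul_left_zero fun x => ?_
  · rw [Metric.nhds_basis_eball.tendsto_right_iff]
    intro r hr
    -- The unit ball times the ball of radius `r` stays in the ball of radius `r`.
    have h1 : Metric.eball (0 : GenNum) 1 ∈ 𝓝 (0 : GenNum) :=
      Metric.eball_mem_nhds _ one_pos
    have h2 : Metric.eball (0 : GenNum) r ∈ 𝓝 (0 : GenNum) := Metric.eball_mem_nhds _ hr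
    filter_upwards [prod_mem_prod h1 h2] with p hp
    have hp1 : p.1.absE < 1 := by
      simpa only [Metric.mem_eball, edist_zero_right] using hp.1
    have hp2 : p.2.absE < r := by
      simpa only [Metric.mem_eball, edist_zero_right] using hp.2
    change edist (p.1 * p.2) 0 < r
    rw [edist_zero_right]
    exact (absE_mul_le_of_lt_one hp1 _).trans_lt hp2
  · simpa only [mul_comm] using tendsto_mul_left_zero x

/-- The ultrametric inequality makes balls around `0` closed under addition, as local convexity
demands. -/
lemma absE_add_le (x y : GenNum) : (x + y).absE ≤ max x.absE y.absE := by
  obtain ⟨a, rfl⟩ := GenNum.mk_surjective x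
  obtain ⟨b, rfl⟩ := GenNum.mk_surjective y
  have h := min_netVal_le (q := fun ε => ‖a.1 ε‖) (q' := fun ε => ‖b.1 ε‖)
    (r := fun ε => ‖(a + b).1 ε‖) fun ε => by simpa using norm_add_le (a.1 ε) (b.1 ε)
  rw [le_max_iff]
  rcases min_le_iff.1 h with h | h
  · exact Or.inl (EReal.exp_le_exp_iff.2 (EReal.neg_le_neg_iff.2 h))
  · exact Or.inr (EReal.exp_le_exp_iff.2 (EReal.neg_le_neg_iff.2 h))

lemma isLocallyConvexModule : IsLocallyConvexModule GenNum where
  addGroup := inferInstance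
  smul := ⟨continuous_mul⟩
  convex U hU := by
    obtain ⟨r, hr, hrU⟩ := EMetric.mem_nhds_iff.1 hU
    refine ⟨_, Metric.eball_mem_nhds _ hr, hrU, fun x hx y hy => ?_⟩
    simp only [Metric.mem_eball, edist_zero_right] at hx hy ⊢
    exact (absE_add_le x y).trans_lt (max_lt hx hy)

end GenNum

/-! ### Continuity criteria for the inductive limit -/

lemma continuous_induced_of_edist_le {X α β : Type*} [PseudoEMetricSpace α]
    [PseudoEMetricSpace β] (g : X → α) (f : X → β) (C : NNReal)
    (h : ∀ x y, edist (f x) (f y) ≤ C * edist (g x) (g y)) :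
    @Continuous X β (TopologicalSpace.induced g inferInstance) _ f := by
  let _ : PseudoEMetricSpace X := PseudoEMetricSpace.induced g inferInstance
  have : LipschitzWith C f := fun x y => h x y
  exact this.continuous

lemma continuous_val_GK {d : ℕ} (K : Compacts (Rn d)) :
    Continuous (X := GK K) (Y := Gc d) Subtype.val :=
  continuous_sInf_rng.2 fun _ ht => ht.2 K

/-- Linear functionals on `Gc` are continuous if their restrictions to all `GK K` are. -/
lemma continuous_of_forall_GK {d : ℕ} (T : Gc d →ₗ[GenNum] GenNum)
    (h : ∀ K : Compacts (Rn d), Continuous fun w : GK K => T w.1) : Continuous T := by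
  rw [continuous_iff_le_induced]
  -- The topology of `Gc` is an infimum of admissible topologies, so it is enough that the one
  -- induced by `T` is admissible; the module structure and local convexity are pulled back from
  -- `GenNum`.
  refine sInf_le ⟨?_, fun K => continuous_induced_rng.2 (h K)⟩
  let _ : TopologicalSpace (Gc d) := TopologicalSpace.induced T inferInstance
  have hind : IsInducing T := ⟨rfl⟩
  refine ⟨topologicalAddGroup_induced T, continuousSMul_induced T, fun U hU => ?_⟩
  rw [hind.nhds_eq_comap, map_zero] at hU
  obtain ⟨V, hV, hVU⟩ := hU
  obtain ⟨A, hA, hAV, hadd⟩ := GenNum.isLocallyConvexModule.convex V hV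
  refine ⟨T ⁻¹' A, ?_, (Set.preimage_mono hAV).trans hVU, fun x hx y hy => ?_⟩
  · rw [hind.nhds_eq_comap, map_zero]
    exact preimage_mem_comap hA
  · change T (x + y) ∈ A
    rw [map_add]
    exact hadd _ hx _ hy

/-! ### Nets of operators acting on classes -/

section GE

variable {E F ι κ : Type*} [AddCommGroup E] [Module ℂ E] [AddCommGroup F] [Module ℂ F]
  {p : ι → Seminorm ℂ E} {q : κ → Seminorm ℂ F}

/-- A net of linear maps, uniformly continuous for the seminorms, acts on classes by
`[(u_ε)_ε] ↦ [(A_ε u_ε)_ε]`. -/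
def GE.mapNet (A : Idx → E →ₗ[ℂ] F)
    (hA : ∀ j, ∃ i, ∃ C : ℝ, ∀ ε x, q j (A ε x) ≤ C * p i x) :
    GE p →ₗ[GenNum] GE q where
  toFun u := Quotient.liftOn' u
    (fun f : modNets p => GE.mk (p := q) ⟨fun ε => A ε (f.1 ε), fun j => by
      obtain ⟨i, C, hC⟩ := hA j
      refine (Moderate.mul (moderate_const C) (f.2 i)).mono fun ε => ?_
      rw [abs_of_nonneg (apply_nonneg _ _)]
      exact (hC _ _).trans (le_abs_self _)⟩)
    (fun f g hfg => by
      have h : f - g ∈ negNets p := (Submodule.quotientRel_def _).1 hfg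
      refine GE.mk_eq.2 fun j => ?_
      obtain ⟨i, C, hC⟩ := hA j
      refine (Moderate.mul_negligible (moderate_const C) (h i)).mono fun ε => ?_
      rw [abs_of_nonneg (apply_nonneg _ _)]
      refine (le_of_eq ?_).trans ((hC ε _).trans (le_abs_self _))
      exact congrArg (q j) (map_sub (A ε) (f.1 ε) (g.1 ε)).symm)
  map_add' u v := by
    obtain ⟨f, rfl⟩ := GE.mk_surjective u
    obtain ⟨g, rfl⟩ := GE.mk_surjective v
    refine congrArg (GE.mk (p := q)) (Subtype.ext (funext fun ε => ?_))
    exact map_add (A ε) (f.1 ε) (g.1 ε)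
  map_smul' c u := by
    obtain ⟨a, rfl⟩ := GenNum.mk_surjective c
    obtain ⟨f, rfl⟩ := GE.mk_surjective u
    refine congrArg (GE.mk (p := q)) (Subtype.ext (funext fun ε => ?_))
    exact map_smul (A ε) (a.1 ε) (f.1 ε)

lemma GE.mk_eq_zero {f : modNets p} :
    GE.mk f = 0 ↔ ∀ i, Negligible fun ε => p i (f.1 ε) := by
  rw [← map_zero (GE.mk (p := p)), GE.mk_eq, sub_zero]; rfl

lemma GE.ups_le_of_val_le {u : GE p} {v : GE q} {i : ι} {j : κ} {N : ℝ}
    (h : u.val i ≤ v.val j + (N : EReal)) :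
    v.ups j ≤ ((Real.exp N).toNNReal : ℝ≥0∞) * u.ups i :=
  exp_neg_le_of_le_add h

end GE

/-- The polynomials in commuting operators and intertwining maps. -/
lemma map_opPow {R M N : Type*} [CommRing R] [AddCommGroup M] [AddCommGroup N] [Module R M]
    [Module R N] {d : ℕ} {A : Fin d → Module.End R M} {B : Fin d → Module.End R N}
    (T : M →ₗ[R] N) (h : ∀ j x, T (A j x) = B j (T x)) (α : Fin d → ℕ) (x : M) :
    T (opPow A α x) = opPow B α (T x) := by
  -- `opPow` is a product over the list of all indices; arbitrary lists make induction possible.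
  have key : ∀ l : List (Fin d), ∀ x,
      T ((l.map fun j => A j ^ α j).prod x) = (l.map fun j => B j ^ α j).prod (T x) := by
    have hpow : ∀ j (n : ℕ) x, T ((A j ^ n) x) = (B j ^ n) (T x) := fun j n => by
      induction n with
      | zero => intro x; simp
      | succ n ih => intro x; rw [pow_succ, pow_succ, Module.End.mul_apply, ih, h]; rfl
    intro l
    induction l with
    | nil => intro x; simp
    | cons j l ih =>
      intro x
      simp only [List.map_cons, List.prod_cons, Module.End.mul_apply]
      rw [hpow, ih]
  simpa only [opPow, List.ofFn_eq_map] using key (List.finRange d) x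

lemma map_polyOp {M N : Type*} [AddCommGroup M] [AddCommGroup N] [Module GenNum M]
    [Module GenNum N] {d : ℕ} {A : Fin d → Module.End GenNum M}
    {B : Fin d → Module.End GenNum N} (T : M →ₗ[GenNum] N)
    (h : ∀ j x, T (A j x) = B j (T x)) (P : MvPolynomial (Fin d) GenNum) (x : M) :
    T (polyOp A P x) = polyOp B P (T x) := by
  simp only [polyOp, LinearMap.sum_apply, map_sum, LinearMap.smul_apply, map_smul]
  exact Finset.sum_congr rfl fun α _ => by rw [map_opPow T h]

/-! ### Operators on smooth functions -/

section Smooth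

variable {d : ℕ}

lemma pSem_mono {K L : Compacts (Rn d)} (h : (K : Set (Rn d)) ⊆ L) {i j : ℕ} (hij : i ≤ j)
    (f : Smooth d) : pSem d (K, i) f ≤ pSem d (L, j) f :=
  pSem_le _ _ (apply_nonneg _ _) fun _ hα _ hx => le_pSem (L, j) (hα.trans hij) f (h hx)

lemma pSem_sup_le (K L : Compacts (Rn d)) (i : ℕ) (f : Smooth d) :
    pSem d (K ⊔ L, i) f ≤ pSem d (K, i) f + pSem d (L, i) f := by
  refine pSem_le _ _ (add_nonneg (apply_nonneg _ _) (apply_nonneg _ _)) fun α hα x hx => ?_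
  rcases hx with hx | hx
  · exact (le_pSem (K, i) hα f hx).trans (le_add_of_nonneg_right (apply_nonneg _ _))
  · exact (le_pSem (L, i) hα f hx).trans (le_add_of_nonneg_left (apply_nonneg _ _))

lemma opPow_pd_zero (f : Smooth d) : opPow pd 0 f = f := by
  have : opPow (pd (d := d)) 0 = 1 := by simp [opPow]
  rw [this]; rfl

lemma pSem_zero_le {K : Compacts (Rn d)} {f : Smooth d} {C : ℝ} (hC : 0 ≤ C)
    (h : ∀ x ∈ K, ‖f.1 x‖ ≤ C) : pSem d (K, 0) f ≤ C := by
  refine pSem_le _ _ hC fun α hα x hx => ?_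
  have : α = 0 := funext fun j => by
    have := Finset.sum_eq_zero_iff.1 (Nat.le_zero.1 hα) j (Finset.mem_univ j)
    simpa using this
  rw [this, opPow_pd_zero]
  exact h x hx

lemma norm_le_pSem {K : Compacts (Rn d)} {x : Rn d} (hx : x ∈ K) (i : ℕ) (f : Smooth d) :
    ‖f.1 x‖ ≤ pSem d (K, i) f := by
  have := le_pSem (K, i) (α := 0) (by simp) f hx
  rwa [opPow_pd_zero] at this

/-- A nonzero multi-index is some `β + e_j`. Estimates can thus be raised one order at a time from
order `0`, given a formula for `∂_j` of the object. -/
lemma pSem_succ_le (K : Compacts (Rn d)) (i : ℕ) (f : Smooth d) :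
    pSem d (K, i + 1) f ≤ pSem d (K, 0) f + ∑ j, pSem d (K, i) (pd j f) := by
  have hs : 0 ≤ ∑ j, pSem d (K, i) (pd j f) := Finset.sum_nonneg fun _ _ => apply_nonneg _ _
  refine pSem_le _ _ (add_nonneg (apply_nonneg _ _) hs) fun α hα x hx => ?_
  by_cases h0 : α = 0
  · rw [h0, opPow_pd_zero]
    exact (norm_le_pSem hx 0 f).trans (le_add_of_nonneg_right hs)
  · obtain ⟨j, hj⟩ : ∃ j, α j ≠ 0 := by
      by_contra h
      push Not at h
      exact h0 (funext h)
    obtain ⟨β, rfl⟩ : ∃ β : Fin d → ℕ, α = β + Pi.single j 1 := by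
      refine ⟨α - Pi.single j 1, (tsub_add_cancel_of_le fun k => ?_).symm⟩
      by_cases hk : k = j
      · subst hk; simpa using Nat.one_le_iff_ne_zero.2 hj
      · simp [hk]
    have hβ : ∑ k, β k ≤ i := by
      have : ∑ k, (β + Pi.single j 1 : Fin d → ℕ) k = ∑ k, β k + 1 := by
        simp [Finset.sum_add_distrib]
      have h2 : ∑ k, (β + Pi.single j 1 : Fin d → ℕ) k ≤ i + 1 := hα
      omega
    rw [← opPow_mul pd pd_commute, Module.End.mul_apply]
    refine (le_pSem (K, i) hβ _ hx).trans ?_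
    refine (Finset.single_le_sum (f := fun j => pSem d (K, i) (pd j f))
      (fun _ _ => apply_nonneg _ _) (Finset.mem_univ j)).trans ?_
    exact le_add_of_nonneg_left (apply_nonneg _ _)

lemma pd_apply (j : Fin d) (f : Smooth d) (x : Rn d) :
    (pd j f).1 x = fderiv ℝ f.1 x (EuclideanSpace.single j 1) := rfl

lemma Smooth.differentiableAt (f : Smooth d) (x : Rn d) : DifferentiableAt ℝ f.1 x :=
  (Smooth.contDiff f).differentiable (by simp) x

lemma tsupport_pd_subset (j : Fin d) (f : Smooth d) : tsupport (pd j f).1 ⊆ tsupport f.1 := by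
  refine closure_minimal (fun x hx => ?_) (isClosed_tsupport _)
  refine support_fderiv_subset ℝ fun h => hx ?_
  rw [pd_apply, h]; rfl

lemma tsupport_opPow_pd_subset (α : Fin d → ℕ) (f : Smooth d) :
    tsupport (opPow pd α f).1 ⊆ tsupport f.1 := by
  have hpow : ∀ j (n : ℕ) (f : Smooth d), tsupport ((pd j ^ n) f).1 ⊆ tsupport f.1 := by
    intro j n
    induction n with
    | zero => intro f; exact subset_rfl
    | succ n ih =>
      intro f
      rw [pow_succ, Module.End.mul_apply]
      exact (ih _).trans (tsupport_pd_subset j f)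
  have key : ∀ (l : List (Fin d)) (f : Smooth d),
      tsupport ((l.map fun j => pd j ^ α j).prod f).1 ⊆ tsupport f.1 := by
    intro l
    induction l with
    | nil => intro f; exact subset_rfl
    | cons j l ih =>
      intro f
      rw [List.map_cons, List.prod_cons, Module.End.mul_apply]
      exact (hpow _ _ _).trans (ih f)
  simpa only [opPow, List.ofFn_eq_map] using key (List.finRange d) f

lemma pSem_le_of_tsupport {K L : Compacts (Rn d)} {f : Smooth d} (h : tsupport f.1 ⊆ K) (i : ℕ) :
    pSem d (L, i) f ≤ pSem d (K, i) f := by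
  refine pSem_le _ _ (apply_nonneg _ _) fun α hα x _ => ?_
  by_cases hx : x ∈ K
  · exact le_pSem (K, i) hα f hx
  · rw [image_eq_zero_of_notMem_tsupport fun h' => hx (h (tsupport_opPow_pd_subset α f h')),
      norm_zero]
    exact apply_nonneg _ _

/-- Multiplication by a smooth function. -/
def mulS (χ : Smooth d) : Module.End ℂ (Smooth d) where
  toFun f := ⟨fun x => χ.1 x * f.1 x, (Smooth.contDiff χ).mul (Smooth.contDiff f)⟩
  map_add' _ _ := Subtype.ext <| funext fun _ => mul_add _ _ _
  map_smul' _ _ := Subtype.ext <| funext fun _ => mul_left_comm _ _ _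

lemma pd_mulS (j : Fin d) (χ f : Smooth d) :
    pd j (mulS χ f) = mulS (pd j χ) f + mulS χ (pd j f) := by
  refine Subtype.ext <| funext fun x => ?_
  change fderiv ℝ (fun y => χ.1 y * f.1 y) x _ = fderiv ℝ χ.1 x _ * f.1 x + χ.1 x * fderiv ℝ f.1 x _
  rw [fderiv_fun_mul (Smooth.differentiableAt χ x) (Smooth.differentiableAt f x)]
  simp only [add_apply, smul_apply, smul_eq_mul]
  ring

/-- Induction on the order by the Leibniz rule, with `χ` varying. Only `K ∩ tsupport χ` matters on
the right, and this locality yields the support of `χ u`. -/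
lemma exists_pSem_mulS_le (χ : Smooth d) (i : ℕ) {K L : Compacts (Rn d)}
    (h : (K : Set (Rn d)) ∩ tsupport χ.1 ⊆ L) :
    ∃ C : ℝ, 0 ≤ C ∧ ∀ f, pSem d (K, i) (mulS χ f) ≤ C * pSem d (L, i) f := by
  have base : ∀ χ : Smooth d, (K : Set (Rn d)) ∩ tsupport χ.1 ⊆ L →
      ∃ C : ℝ, 0 ≤ C ∧ ∀ f, pSem d (K, 0) (mulS χ f) ≤ C * pSem d (L, 0) f := by
    intro χ h
    refine ⟨pSem d (K, 0) χ, apply_nonneg _ _, fun f => ?_⟩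
    refine pSem_zero_le (mul_nonneg (apply_nonneg _ _) (apply_nonneg _ _)) fun x hx => ?_
    change ‖χ.1 x * f.1 x‖ ≤ _
    by_cases hx' : x ∈ tsupport χ.1
    · rw [norm_mul]
      exact mul_le_mul (norm_le_pSem hx 0 χ) (norm_le_pSem (h ⟨hx, hx'⟩) 0 f) (norm_nonneg _)
        (apply_nonneg _ _)
    · rw [image_eq_zero_of_notMem_tsupport hx', zero_mul, norm_zero]
      exact mul_nonneg (apply_nonneg _ _) (apply_nonneg _ _)
  induction i generalizing χ with
  | zero => exact base χ h
  | succ i ih =>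
    obtain ⟨C₀, hC₀, h₀⟩ := base χ h
    obtain ⟨C₁, hC₁, h₁⟩ := ih χ h
    choose C hC h₂ using fun j => ih (pd j χ)
      ((Set.inter_subset_inter_right _ (tsupport_pd_subset j χ)).trans h)
    refine ⟨C₀ + ∑ j, (C j + C₁), add_nonneg hC₀
      (Finset.sum_nonneg fun j _ => add_nonneg (hC j) hC₁), fun f => ?_⟩
    refine (pSem_succ_le K i _).trans ?_
    rw [add_mul, Finset.sum_mul]
    refine add_le_add ((h₀ f).trans (mul_le_mul_of_nonneg_left
      (pSem_mono subset_rfl (Nat.zero_le _) f) hC₀)) (Finset.sum_le_sum fun j _ => ?_)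
    rw [pd_mulS, add_mul]
    refine (map_add_le_add _ _ _).trans (add_le_add ((h₂ j f).trans
      (mul_le_mul_of_nonneg_left (pSem_mono subset_rfl (Nat.le_succ _) f) (hC j)))
      ((h₁ _).trans (mul_le_mul_of_nonneg_left (pSem_pd L i j f) hC₁)))

/-- Composition with the affine map `y ↦ s • y + a`. -/
def affS (s : ℝ) (a : Rn d) : Module.End ℂ (Smooth d) where
  toFun f := ⟨fun y => f.1 (s • y + a),
    (Smooth.contDiff f).comp (by fun_prop : ContDiff ℝ ∞ fun y : Rn d => s • y + a)⟩
  map_add' _ _ := rfl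
  map_smul' _ _ := rfl

lemma affS_apply (s : ℝ) (a : Rn d) (f : Smooth d) (y : Rn d) :
    (affS s a f).1 y = f.1 (s • y + a) := rfl

lemma pd_affS (j : Fin d) (s : ℝ) (a : Rn d) (f : Smooth d) :
    pd j (affS s a f) = (s : ℂ) • affS s a (pd j f) := by
  refine Subtype.ext <| funext fun x => ?_
  have h1 : HasFDerivAt (fun y : Rn d => s • y + a) (s • ContinuousLinearMap.id ℝ (Rn d)) x :=
    ((hasFDerivAt_id x).const_smul s).add_const a
  have h2 := (Smooth.differentiableAt f (s • x + a)).hasFDerivAt.comp x h1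
  change fderiv ℝ (f.1 ∘ fun y => s • y + a) x _ = (s : ℂ) * fderiv ℝ f.1 (s • x + a) _
  rw [h2.fderiv]
  simp

/-- The constant depends neither on `s` nor on `a`, so the translation may vary with `ε`; `|s| ≤ 1`
absorbs the chain rule factor. -/
lemma exists_pSem_affS_le (d i : ℕ) : ∃ C : ℝ, 0 ≤ C ∧ ∀ (s : ℝ) (a : Rn d)
    (K L : Compacts (Rn d)), |s| ≤ 1 → (∀ y ∈ K, s • y + a ∈ L) →
    ∀ f, pSem d (K, i) (affS s a f) ≤ C * pSem d (L, i) f := by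
  have base : ∀ (s : ℝ) (a : Rn d) (K L : Compacts (Rn d)), (∀ y ∈ K, s • y + a ∈ L) →
      ∀ f, pSem d (K, 0) (affS s a f) ≤ pSem d (L, 0) f := fun s a K L h f =>
    pSem_zero_le (apply_nonneg _ _) fun x hx => norm_le_pSem (h x hx) 0 f
  induction i with
  | zero => exact ⟨1, zero_le_one, fun s a K L _ h f => by rw [one_mul]; exact base s a K L h f⟩
  | succ i ih =>
    obtain ⟨C, hC, h₁⟩ := ih
    refine ⟨1 + ∑ _j : Fin d, C, add_nonneg zero_le_one (Finset.sum_nonneg fun _ _ => hC),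
      fun s a K L hs h f => (pSem_succ_le K i _).trans ?_⟩
    rw [add_mul, one_mul, Finset.sum_mul]
    refine add_le_add ((base s a K L h f).trans (pSem_mono subset_rfl (Nat.zero_le _) f))
      (Finset.sum_le_sum fun j _ => ?_)
    rw [pd_affS, map_smul_eq_mul]
    refine (mul_le_of_le_one_left (apply_nonneg _ _) (by simpa using hs)).trans ?_
    exact (h₁ s a K L hs h _).trans (mul_le_mul_of_nonneg_left (pSem_pd L i j f) hC)

/-- Smooth cut-off functions. -/
lemma exists_cutoff {C U : Set (Rn d)} (hC : IsClosed C) (hU : IsOpen U) (h : C ⊆ U) :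
    ∃ χ : Smooth d, tsupport χ.1 ⊆ U ∧ ∃ W, IsOpen W ∧ C ⊆ W ∧ ∀ x ∈ W, χ.1 x = 1 := by
  obtain ⟨f, h0, h1, -⟩ := exists_contMDiffMap_zero_one_nhds_of_isClosed
    (n := ⊤) (modelWithCornersSelf ℝ (Rn d)) hU.isClosed_compl hC
    (Set.disjoint_left.2 fun x hx hx' => hx (h hx'))
  have hf : ContDiff ℝ ∞ (f : Rn d → ℝ) := f.contMDiff.contDiff
  -- Being `0` or `1` on neighbourhoods, not just on the sets, controls the closed supports of `χ`
  -- and `1 - χ`.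
  obtain ⟨W, hW, hCW, hW1⟩ := mem_nhdsSet_iff_exists.1 h1
  obtain ⟨W', hW', hUW', hW0⟩ := mem_nhdsSet_iff_exists.1 h0
  refine ⟨⟨fun x => (f x : ℂ), Complex.ofRealCLM.contDiff.comp hf⟩, ?_, W, hW, hCW,
    fun x hx => by
      have : f x = 1 := hW1 hx
      simp [this]⟩
  have : tsupport (fun x => (f x : ℂ)) ⊆ W'ᶜ :=
    closure_minimal (fun x hx hx' => hx (by
      have : f x = 0 := hW0 hx'
      simp [this])) hW'.isClosed_compl
  intro x hx
  by_contra hxU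
  exact this hx (hUW' hxU)

lemma exists_cutoff_compact {C U : Set (Rn d)} (hC : IsCompact C) (hU : IsOpen U) (h : C ⊆ U) :
    ∃ χ : Smooth d, HasCompactSupport χ.1 ∧ tsupport χ.1 ⊆ U ∧
      ∃ W, IsOpen W ∧ C ⊆ W ∧ ∀ x ∈ W, χ.1 x = 1 := by
  obtain ⟨K, hK, hCK, hKU⟩ := exists_compact_between hC hU h
  obtain ⟨χ, h1, h2⟩ := exists_cutoff hC.isClosed isOpen_interior hCK
  exact ⟨χ, hK.of_isClosed_subset (isClosed_tsupport _) (h1.trans interior_subset),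
    (h1.trans interior_subset).trans hKU, h2⟩

end Smooth

/-! ### Supports, multiplication and affine substitutions on the Colombeau algebra -/

section Support

variable {d : ℕ}

lemma Negligible.sum {ι : Type*} (s : Finset ι) {q : ι → Idx → ℝ}
    (h : ∀ i ∈ s, Negligible (q i)) : Negligible fun ε => ∑ i ∈ s, q i ε := fun m => by
  have := IsBigO.sum fun i hi => h i hi m
  rwa [Finset.sum_fn] at this

/-- Representatives differ by a negligible net, so the chosen one may replace the existential one.
-/
lemma vanishesOn_mk {f : modNets (pSem d)} {V : Set (Rn d)} :
    VanishesOn (GE.mk f) V ↔ ∀ K : Compacts (Rn d), (K : Set (Rn d)) ⊆ V →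
      ∀ i, Negligible fun ε => pSem d (K, i) (f.1 ε) := by
  refine ⟨fun ⟨g, hg, h⟩ K hK i => ?_, fun h => ⟨f, rfl, h⟩⟩
  have h1 : f - g ∈ negNets (pSem d) := GE.mk_eq.1 hg.symm
  refine (Negligible.add (h1 (K, i)) (h K hK i)).mono fun ε => ?_
  rw [abs_of_nonneg (apply_nonneg _ _),
    abs_of_nonneg (add_nonneg (apply_nonneg _ _) (apply_nonneg _ _))]
  have h2 := map_add_le_add (pSem d (K, i)) ((f - g).1 ε) (g.1 ε)
  have h3 : (f - g).1 ε + g.1 ε = f.1 ε := sub_add_cancel _ _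
  rwa [h3] at h2

lemma VanishesOn.mono {u : G d} {V W : Set (Rn d)} (h : VanishesOn u W) (hVW : V ⊆ W) :
    VanishesOn u V := by
  obtain ⟨f, hf, h⟩ := h
  exact ⟨f, hf, fun K hK => h K (hK.trans hVW)⟩

lemma VanishesOn.eq_zero {u : G d} (h : VanishesOn u Set.univ) : u = 0 := by
  obtain ⟨f, rfl⟩ := GE.mk_surjective u
  exact GE.mk_eq_zero.2 fun k => vanishesOn_mk.1 h k.1 (Set.subset_univ _) k.2

/-- Compactness: finitely many compact neighbourhoods cover `K`, and their seminorms add up to a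
bound on the union. -/
lemma vanishesOn_of_locally {u : G d} {V : Set (Rn d)}
    (h : ∀ x ∈ V, ∃ W, IsOpen W ∧ x ∈ W ∧ VanishesOn u W) : VanishesOn u V := by
  obtain ⟨f, rfl⟩ := GE.mk_surjective u
  refine vanishesOn_mk.2 fun K hK => ?_
  have key : ∃ L : Compacts (Rn d), (K : Set (Rn d)) ⊆ L ∧
      ∀ i, Negligible fun ε => pSem d (L, i) (f.1 ε) := by
    refine K.isCompact.induction_on (p := fun s => ∃ L : Compacts (Rn d), s ⊆ L ∧
      ∀ i, Negligible fun ε => pSem d (L, i) (f.1 ε)) ?_ ?_ ?_ ?_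
    · refine ⟨⊥, Set.empty_subset _, fun i => negligible_zero.mono fun ε => ?_⟩
      have : pSem d (⊥, i) (f.1 ε) ≤ 0 := pSem_le _ _ le_rfl fun _ _ x hx => absurd hx
        (Set.notMem_empty x)
      rw [le_antisymm this (apply_nonneg _ _)]
    · rintro s t hst ⟨L, hL, h⟩
      exact ⟨L, hst.trans hL, h⟩
    · rintro s t ⟨L, hL, h⟩ ⟨L', hL', h'⟩
      refine ⟨L ⊔ L', Set.union_subset_union hL hL', fun i =>
        ((h i).add (h' i)).mono fun ε => ?_⟩
      rw [abs_of_nonneg (apply_nonneg _ _)]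
      exact (pSem_sup_le L L' i _).trans (le_abs_self _)
    · intro x hx
      obtain ⟨W, hW, hxW, hu⟩ := h x (hK hx)
      obtain ⟨L, hL, hxL, hLW⟩ := exists_compact_subset hW hxW
      exact ⟨interior L, mem_nhdsWithin_of_mem_nhds (isOpen_interior.mem_nhds hxL),
        ⟨L, hL⟩, interior_subset, fun i => vanishesOn_mk.1 hu ⟨L, hL⟩ hLW i⟩
  obtain ⟨L, hKL, hL⟩ := key
  refine fun i => (hL i).mono fun ε => ?_
  rw [abs_of_nonneg (apply_nonneg _ _), abs_of_nonneg (apply_nonneg _ _)]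
  exact pSem_mono hKL le_rfl _

lemma vanishesOn_compl_supp (u : G d) : VanishesOn u (supp u)ᶜ := by
  refine vanishesOn_of_locally fun x hx => ?_
  simp only [supp, Set.mem_compl_iff, Set.mem_ofPred_eq, not_forall, not_not] at hx
  obtain ⟨V, hV, hxV, hu⟩ := hx
  exact ⟨V, hV, hxV, hu⟩

lemma supp_subset_of_vanishesOn {u : G d} {C : Set (Rn d)} (hC : IsClosed C)
    (h : VanishesOn u Cᶜ) : supp u ⊆ C := fun x hx => by
  by_contra hxC
  exact hx _ hC.isOpen_compl hxC h

/-- Multiplication by a smooth function. -/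
def mulG (χ : Smooth d) : Module.End GenNum (G d) :=
  GE.map (mulS χ) fun k => by
    obtain ⟨C, -, hC⟩ := exists_pSem_mulS_le χ k.2 (K := k.1) (L := k.1) Set.inter_subset_left
    exact ⟨k, C, hC⟩

lemma vanishesOn_mulG {χ : Smooth d} {u : G d} {V W : Set (Rn d)} (h : VanishesOn u W)
    (hV : V ∩ tsupport χ.1 ⊆ W) : VanishesOn (mulG χ u) V := by
  obtain ⟨f, rfl⟩ := GE.mk_surjective u
  refine ⟨_, rfl, fun K hK i => ?_⟩
  let L : Compacts (Rn d) :=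
    ⟨K ∩ tsupport χ.1, K.isCompact.inter_right (isClosed_tsupport _)⟩
  obtain ⟨C, -, hC⟩ := exists_pSem_mulS_le χ i (K := K) (L := L) subset_rfl
  refine ((moderate_const C).mul_negligible (vanishesOn_mk.1 h L
    ((Set.inter_subset_inter_left _ hK).trans hV) i)).mono fun ε => ?_
  rw [abs_of_nonneg (apply_nonneg _ _)]
  exact (hC _).trans (le_abs_self _)

lemma supp_mulG_subset (χ : Smooth d) (u : G d) : supp (mulG χ u) ⊆ tsupport χ.1 ∩ supp u := by
  refine supp_subset_of_vanishesOn ((isClosed_tsupport _).inter (isClosed_supp u))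
    (vanishesOn_mulG (vanishesOn_compl_supp u) fun x hx hxu => hx.1 ⟨hx.2, hxu⟩)

/-- The constant function `1`. -/
def oneS (d : ℕ) : Smooth d := ⟨fun _ => 1, by
  change ContDiff ℝ ∞ fun _ => (1 : ℂ)
  exact contDiff_const⟩

lemma mulG_one_sub (χ : Smooth d) (u : G d) : mulG (oneS d - χ) u = u - mulG χ u := by
  obtain ⟨f, rfl⟩ := GE.mk_surjective u
  refine congrArg GE.mk (Subtype.ext <| funext fun ε => Subtype.ext <| funext fun x => ?_)
  change (1 - χ.1 x) * (f.1 ε).1 x = (f.1 ε).1 x - χ.1 x * (f.1 ε).1 x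
  ring

lemma tsupport_one_sub_subset {χ : Smooth d} {W : Set (Rn d)} (hW : IsOpen W)
    (h : ∀ x ∈ W, χ.1 x = 1) : tsupport (oneS d - χ).1 ⊆ Wᶜ := by
  refine closure_minimal (fun x hx hxW => hx ?_) hW.isClosed_compl
  change 1 - χ.1 x = 0
  rw [h x hxW, sub_self]

lemma mulG_eq_self {χ : Smooth d} {u : G d} {W : Set (Rn d)} (hW : IsOpen W)
    (h : ∀ x ∈ W, χ.1 x = 1) (hu : supp u ⊆ W) : mulG χ u = u := by
  have h1 : mulG (oneS d - χ) u = 0 :=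
    (vanishesOn_mulG (V := Set.univ) (vanishesOn_compl_supp u) fun x hx hxu =>
      tsupport_one_sub_subset hW h hx.2 (hu hxu)).eq_zero
  rw [mulG_one_sub, sub_eq_zero] at h1
  exact h1.symm

/-- The compact set `s • K + L`. -/
def affCompact (s : ℝ) (K L : Compacts (Rn d)) : Compacts (Rn d) :=
  ⟨(fun p : Rn d × Rn d => s • p.1 + p.2) '' ((K : Set (Rn d)) ×ˢ L),
    (K.isCompact.prod L.isCompact).image (by fun_prop)⟩

lemma mem_affCompact {s : ℝ} {K L : Compacts (Rn d)} {y b : Rn d} (hy : y ∈ K) (hb : b ∈ L) :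
    s • y + b ∈ affCompact s K L := ⟨(y, b), ⟨hy, hb⟩, rfl⟩

/-- The substitution `y ↦ s • y + a_ε`, where `s = ±1` and the net `a` is bounded. -/
def affG (s : ℝ) (hs : s * s = 1) (a : Idx → Rn d) (L : Compacts (Rn d)) (ha : ∀ ε, a ε ∈ L) :
    Module.End GenNum (G d) :=
  GE.mapNet (fun ε => affS s (a ε)) fun k => by
    obtain ⟨C, -, hC⟩ := exists_pSem_affS_le d k.2
    exact ⟨(affCompact s k.1 L, k.2), C, fun ε f => hC s (a ε) _ _
      (abs_le_one_iff_mul_self_le_one.2 hs.le) (fun y hy => mem_affCompact hy (ha ε)) f⟩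

lemma vanishesOn_affG {s : ℝ} {hs : s * s = 1} {a : Idx → Rn d} {L : Compacts (Rn d)}
    {ha : ∀ ε, a ε ∈ L} {u : G d} {V W : Set (Rn d)} (h : VanishesOn u W)
    (hV : ∀ y ∈ V, ∀ b ∈ L, s • y + b ∈ W) : VanishesOn (affG s hs a L ha u) V := by
  obtain ⟨f, rfl⟩ := GE.mk_surjective u
  refine ⟨_, rfl, fun K hK i => ?_⟩
  obtain ⟨C, -, hC⟩ := exists_pSem_affS_le d i
  refine ((moderate_const C).mul_negligible (vanishesOn_mk.1 h (affCompact s K L) ?_ i)).mono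
    fun ε => ?_
  · rintro _ ⟨p, hp, rfl⟩
    exact hV _ (hK hp.1) _ hp.2
  · rw [abs_of_nonneg (apply_nonneg _ _)]
    exact (hC s (a ε) _ _ (abs_le_one_iff_mul_self_le_one.2 hs.le)
      (fun y hy => mem_affCompact hy (ha ε)) _).trans (le_abs_self _)

/-- As `s² = 1`, the inverse of `y ↦ s y + b` is `z ↦ s (z - b)`; of the net `a` only its range in
`L` is known, hence all `b ∈ L` appear. -/
lemma supp_affG_subset {s : ℝ} {hs : s * s = 1} {a : Idx → Rn d} {L : Compacts (Rn d)}
    {ha : ∀ ε, a ε ∈ L} {u : G d} (hu : IsCompact (supp u)) :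
    supp (affG s hs a L ha u) ⊆
      (fun p : Rn d × Rn d => s • (p.1 - p.2)) '' (supp u ×ˢ (L : Set (Rn d))) := by
  refine supp_subset_of_vanishesOn
    ((hu.prod L.isCompact).image (by fun_prop)).isClosed
    (vanishesOn_affG (vanishesOn_compl_supp u) fun y hy b hb hyb => hy ?_)
  refine ⟨(s • y + b, b), ⟨hyb, hb⟩, ?_⟩
  simp [smul_smul, hs]

lemma pdG_affG {s : ℝ} {hs : s * s = 1} {a : Idx → Rn d} {L : Compacts (Rn d)}
    {ha : ∀ ε, a ε ∈ L} (j : Fin d) (u : G d) :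
    pdG j (affG s hs a L ha u) = GenNum.const (s : ℂ) • affG s hs a L ha (pdG j u) := by
  obtain ⟨f, rfl⟩ := GE.mk_surjective u
  exact congrArg GE.mk (Subtype.ext (funext fun ε => pd_affS j s (a ε) (f.1 ε)))

/-- Evaluation at `0`. -/
def delta0 (d : ℕ) : G d →ₗ[GenNum] GenNum :=
  GE.form (p := pSem d) ((LinearMap.proj (0 : Rn d)) ∘ₗ (Smooth d).subtype)
    ⟨(⟨{0}, isCompact_singleton⟩, 0), 1, fun f => by
      rw [one_mul]
      exact norm_le_pSem (K := ⟨{0}, isCompact_singleton⟩) (x := 0) rfl 0 f⟩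

lemma delta_apply (w : Gc d) : delta d w = delta0 d (incl d w) := rfl

/-- A set of generalized functions, stable under differentiation, whose elements have vanishing
point values in `V`, consists of generalized functions vanishing on `V`. -/
lemma vanishesOn_of_pointValues {Z : Set (G d)} {V : Set (Rn d)}
    (hZ : ∀ u ∈ Z, ∀ j, pdG j u ∈ Z)
    (h : ∀ u ∈ Z, ∀ (a : Idx → Rn d) (L : Compacts (Rn d)) (ha : ∀ ε, a ε ∈ L),
      (L : Set (Rn d)) ⊆ V → delta0 d (affG 1 (one_mul 1) a L ha u) = 0)
    {u : G d} (hu : u ∈ Z) : VanishesOn u V := by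
  obtain ⟨f, rfl⟩ := GE.mk_surjective u
  refine vanishesOn_mk.2 fun K hK i => ?_
  have base : ∀ f : modNets (pSem d), GE.mk f ∈ Z →
      Negligible fun ε => pSem d (K, 0) (f.1 ε) := by
    intro f hf
    rcases (K : Set (Rn d)).eq_empty_or_nonempty with hK0 | hK0
    · refine negligible_zero.mono fun ε => ?_
      have : pSem d (K, 0) (f.1 ε) ≤ 0 := pSem_zero_le le_rfl fun x hx => by
        have : x ∈ (K : Set (Rn d)) := hx
        rw [hK0] at this
        exact this.elim
      rw [le_antisymm this (apply_nonneg _ _)]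
    -- With `a ε` a maximum point of `|f_ε|` on `K`, the value at `a ε` is the whole seminorm of
    -- order `0`.
    · choose a ha hmax using fun ε => K.isCompact.exists_isMaxOn hK0
        (Smooth.contDiff (f.1 ε)).continuous.norm.continuousOn
      have h1 := h _ hf a K ha hK
      have h2 : Negligible fun ε => ‖(affS 1 (a ε) (f.1 ε)).1 0‖ := by
        rw [← map_zero GenNum.mk] at h1
        have := GenNum.mk_eq.1 h1
        rw [sub_zero] at this
        exact this
      refine h2.mono fun ε => ?_
      rw [abs_of_nonneg (apply_nonneg _ _), abs_norm, affS_apply, smul_zero, zero_add]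
      exact pSem_zero_le (norm_nonneg _) fun x hx => hmax ε hx
  induction i generalizing f with
  | zero => exact base f hu
  | succ i ih =>
    refine ((base f hu).add (Negligible.sum Finset.univ fun j _ => ih ⟨fun ε => pd j (f.1 ε), _⟩
      (hZ _ hu j))).mono fun ε => ?_
    rw [abs_of_nonneg (apply_nonneg _ _)]
    exact (pSem_succ_le K i _).trans (le_abs_self _)

/-! ### Compactly supported generalized functions -/

lemma incl_injective : Function.Injective (incl d) := Subtype.val_injective

lemma isCompact_supp_incl (w : Gc d) : IsCompact (supp (incl d w)) := w.2

lemma incl_pdGc (j : Fin d) (w : Gc d) : incl d (pdGc j w) = pdG j (incl d w) := rfl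

/-- Multiplication by a test function. -/
def mulToGc (χ : Smooth d) (hχ : HasCompactSupport χ.1) : G d →ₗ[GenNum] Gc d :=
  (mulG χ).codRestrict (cptSupp d) fun u =>
    hχ.isCompact.of_isClosed_subset (isClosed_supp _)
      ((supp_mulG_subset χ u).trans Set.inter_subset_left)

lemma incl_mulToGc (χ : Smooth d) (hχ : HasCompactSupport χ.1) (u : G d) :
    incl d (mulToGc χ hχ u) = mulG χ u := rfl

/-- The substitution `y ↦ s • y + a_ε` on compactly supported generalized functions. -/
def affGc (s : ℝ) (hs : s * s = 1) (a : Idx → Rn d) (L : Compacts (Rn d)) (ha : ∀ ε, a ε ∈ L) :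
    Module.End GenNum (Gc d) :=
  LinearMap.restrict (p := cptSupp d) (q := cptSupp d) (affG s hs a L ha) fun _ hu =>
    (((show IsCompact (supp _) from hu).prod L.isCompact).image
      (by fun_prop)).of_isClosed_subset (isClosed_supp _) (supp_affG_subset hu)

lemma incl_affGc (s : ℝ) (hs : s * s = 1) (a : Idx → Rn d) (L : Compacts (Rn d))
    (ha : ∀ ε, a ε ∈ L) (w : Gc d) :
    incl d (affGc s hs a L ha w) = affG s hs a L ha (incl d w) := rfl

/-- A functional vanishes on the `w` whose support does not meet the support of the functional. -/
lemma apply_eq_zero_of_disjoint_dsupp (T : Gc d →ₗ[GenNum] GenNum) (w : Gc d)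
    (h : Disjoint (supp (incl d w)) (dsupp T)) : T w = 0 := by
  have key : ∃ U, IsOpen U ∧ supp (incl d w) ⊆ U ∧
      ∀ w : Gc d, supp (incl d w) ⊆ U → T w = 0 := by
    refine (isCompact_supp_incl w).induction_on (p := fun s => ∃ U, IsOpen U ∧ s ⊆ U ∧
      ∀ w : Gc d, supp (incl d w) ⊆ U → T w = 0) ?_ ?_ ?_ ?_
    · refine ⟨∅, isOpen_empty, subset_rfl, fun w hw => ?_⟩
      have : incl d w = 0 := ((vanishesOn_compl_supp (incl d w)).mono fun x _ hx => hw hx).eq_zero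
      rw [incl_injective (this.trans (map_zero (incl d)).symm), map_zero]
    · rintro s t hst ⟨U, hU, htU, h⟩
      exact ⟨U, hU, hst.trans htU, h⟩
    · rintro s t ⟨U, hU, hsU, h⟩ ⟨U', hU', htU', h'⟩
      refine ⟨U ∪ U', hU.union hU', Set.union_subset_union hsU htU', fun w hw => ?_⟩
      -- Split `w = χ w + (1 - χ) w` with `χ = 1` near the part of the support outside `U'` and
      -- `supp χ ⊆ U`; the first term lives in `U`, the second in `U'`.
      obtain ⟨χ, hc, hχ, W, hW, hCW, hW1⟩ := exists_cutoff_compact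
        ((isCompact_supp_incl w).diff hU') hU fun x hx => (hw hx.1).resolve_right hx.2
      have h1 : T (mulToGc χ hc (incl d w)) = 0 :=
        h _ ((supp_mulG_subset _ _).trans (Set.inter_subset_left.trans hχ))
      have h2 : T (w - mulToGc χ hc (incl d w)) = 0 := by
        refine h' _ ?_
        rw [map_sub, incl_mulToGc, ← mulG_one_sub]
        intro x hx
        have hx' := supp_mulG_subset _ _ hx
        by_contra hxU
        exact tsupport_one_sub_subset hW hW1 hx'.1 (hCW ⟨hx'.2, hxU⟩)
      rw [map_sub, h1, sub_zero] at h2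
      exact h2
    · intro x hx
      have hxT : x ∉ dsupp T := Set.disjoint_left.1 h hx
      simp only [dsupp, Set.mem_ofPred_eq, not_forall, not_exists, not_and, not_not] at hxT
      obtain ⟨V, hV, hxV, hT⟩ := hxT
      exact ⟨V, mem_nhdsWithin_of_mem_nhds (hV.mem_nhds hxV), V, hV, subset_rfl, hT⟩
  obtain ⟨U, -, hwU, h⟩ := key
  exact h w hwU

end Support

/-! ### Test functions and regularization of distributions -/

section Test

variable {d : ℕ}

/-- Test functions on `ℝ^d`. -/
abbrev Test (d : ℕ) : Type := 𝓓((⊤ : Opens (Rn d)), ℂ)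

/-- A smooth function with compact support regarded as a test function. -/
def toTest (f : Smooth d) (h : HasCompactSupport f.1) : Test d :=
  ⟨f.1, f.2, h, Set.subset_univ _⟩

lemma ofTest_injective : Function.Injective (ofTest (d := d)) := fun _ _ h =>
  DFunLike.ext' (congrArg Subtype.val h)

/-- The compact set `K - L`. -/
def subCompact (K L : Compacts (Rn d)) : Compacts (Rn d) :=
  ⟨(fun p : Rn d × Rn d => p.1 - p.2) '' ((K : Set (Rn d)) ×ˢ L),
    (K.isCompact.prod L.isCompact).image (by fun_prop)⟩

lemma tsupport_affS_subset {f : Smooth d} {K L : Compacts (Rn d)} (hf : tsupport f.1 ⊆ K)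
    {a : Rn d} (ha : a ∈ L) : tsupport (affS 1 a f).1 ⊆ subCompact K L := by
  refine closure_minimal (fun x hx => ?_) (subCompact K L).isCompact.isClosed
  refine ⟨(x + a, a), ⟨hf (subset_tsupport _ ?_), ha⟩, by simp⟩
  have h : f.1 ((1 : ℝ) • x + a) ≠ 0 := hx
  rwa [one_smul] at h

lemma hasCompactSupport_affS {f : Smooth d} (hf : HasCompactSupport f.1) (a : Rn d) :
    HasCompactSupport (affS 1 a f).1 :=
  (subCompact ⟨_, hf⟩ ⟨_, isCompact_singleton⟩).isCompact.of_isClosed_subset (isClosed_tsupport _)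
    (tsupport_affS_subset (K := ⟨_, hf⟩) (L := ⟨_, isCompact_singleton⟩) subset_rfl rfl)

/-- The translate `g(· + a)` of a test function. -/
def shiftT (a : Rn d) : Module.End ℂ (Test d) where
  toFun g := toTest (affS 1 a (ofTest g)) (hasCompactSupport_affS g.hasCompactSupport a)
  map_add' _ _ := rfl
  map_smul' _ _ := rfl

lemma shiftT_apply (a : Rn d) (g : Test d) (x : Rn d) : shiftT a g x = g ((1 : ℝ) • x + a) := rfl

lemma tsupport_shiftT_subset {g : Test d} {K L : Compacts (Rn d)} (hg : tsupport g ⊆ K)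
    {a : Rn d} (ha : a ∈ L) : tsupport (shiftT a g) ⊆ subCompact K L :=
  tsupport_affS_subset (f := ofTest g) hg ha

/-- `∂_j` on test functions. -/
def pdT (j : Fin d) : Module.End ℂ (Test d) where
  toFun g := toTest (pd j (ofTest g)) (g.hasCompactSupport.of_isClosed_subset
    (isClosed_tsupport _) (tsupport_pd_subset j (ofTest g)))
  map_add' f g := ofTest_injective (map_add (pd j) (ofTest f) (ofTest g))
  map_smul' c g := ofTest_injective (map_smul (pd j) c (ofTest g))

lemma tsupport_pdT_subset (j : Fin d) (g : Test d) : tsupport (pdT j g) ⊆ tsupport g :=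
  tsupport_pd_subset j (ofTest g)

/-! ### Finite order of distributions and smoothness of `x ↦ S (g(x + ·))` -/

/-- Links the seminorms of the test function topology, built from iterated Fréchet derivatives, to
`pSem`, built from partial ones. -/
lemma exists_norm_iteratedFDeriv_le (d i : ℕ) : ∃ C : ℝ, 0 ≤ C ∧ ∀ (f : Smooth d)
    (K : Compacts (Rn d)), ∀ x ∈ K, ‖iteratedFDeriv ℝ i f.1 x‖ ≤ C * pSem d (K, i) f := by
  induction i with
  | zero =>
    refine ⟨1, zero_le_one, fun f K x hx => ?_⟩
    rw [norm_iteratedFDeriv_zero, one_mul]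
    exact norm_le_pSem hx 0 f
  | succ i ih =>
    obtain ⟨C, hC, h⟩ := ih
    let Φ : Fin d → ℂ →L[ℝ] (Rn d →L[ℝ] ℂ) := fun j =>
      ContinuousLinearMap.smulRightL ℝ (Rn d) ℂ (EuclideanSpace.proj j)
    refine ⟨∑ j, ‖Φ j‖ * C, Finset.sum_nonneg fun j _ => mul_nonneg (Φ j).opNorm_nonneg hC,
      fun f K x hx => ?_⟩
    -- The differential as `∑ ∂_j f dx_j`, where each `Φ j` is a fixed continuous linear map.
    have hfd : fderiv ℝ f.1 = fun x => ∑ j, (Φ j ∘ (pd j f).1) x := by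
      funext x
      ext v
      have hv : v = ∑ j, v j • EuclideanSpace.single j (1 : ℝ) := by
        ext k
        simp [Finset.sum_apply, Pi.single_apply]
      conv_lhs => rw [hv]
      rw [map_sum, sum_apply]
      refine Finset.sum_congr rfl fun j _ => ?_
      rw [map_smul]
      rfl
    rw [← norm_iteratedFDeriv_fderiv, hfd, iteratedFDeriv_fun_sum_apply fun j _ =>
      ((Φ j).contDiff.comp ((Smooth.contDiff (pd j f)).of_le
        (by exact_mod_cast le_top))).contDiffAt]
    refine (norm_sum_le _ _).trans ?_
    rw [Finset.sum_mul]
    refine Finset.sum_le_sum fun j _ => ?_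
    refine ((Φ j).norm_iteratedFDeriv_comp_left (N := ∞)
      (Smooth.contDiff (pd j f)).contDiffAt (by exact_mod_cast le_top)).trans ?_
    rw [mul_assoc]
    exact mul_le_mul_of_nonneg_left ((h (pd j f) K x hx).trans
      (mul_le_mul_of_nonneg_left (pSem_pd K i j f) hC)) (Φ j).opNorm_nonneg

/-- A distribution has finite order on `K`: its restriction to test functions supported in `K` is
bounded by finitely many seminorms, and `j` is the largest order among them. -/
lemma exists_norm_le_pSem (S : Test d →L[ℂ] ℂ) (K : Compacts (Rn d)) :
    ∃ (j : ℕ) (C : ℝ), 0 ≤ C ∧ ∀ g : Test d, tsupport g ⊆ K →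
      ‖S g‖ ≤ C * pSem d (K, j) (ofTest g) := by
  have hK : (K : Set (Rn d)) ⊆ (⊤ : Opens (Rn d)) := Set.subset_univ _
  let T := S ∘L TestFunction.ofSupportedInCLM ℂ (F := ℂ) (n := ⊤) hK
  obtain ⟨s, C, -, hC⟩ := Seminorm.bound_of_continuous
    (ContDiffMapSupportedIn.withSeminorms ℂ (Rn d) ℂ ⊤ K)
    ((normSeminorm ℂ ℂ).comp T.toLinearMap) T.continuous.norm
  choose B hB hB' using exists_norm_iteratedFDeriv_le d
  refine ⟨s.sup id, C * ∑ i ∈ s, B i, mul_nonneg C.2 (Finset.sum_nonneg fun i _ => hB i),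
    fun g hg => ?_⟩
  let f : 𝓓_{K}(Rn d, ℂ) := .of_support_subset g.contDiff (subset_closure.trans hg)
  refine (hC f).trans ?_
  rw [mul_assoc]
  refine mul_le_mul_of_nonneg_left (Seminorm.finset_sup_apply_le
    (mul_nonneg (Finset.sum_nonneg fun i _ => hB i) (apply_nonneg _ _)) fun i hi => ?_) C.2
  have h0 : B i ≤ ∑ i ∈ s, B i := Finset.single_le_sum (fun i _ => hB i) hi
  have h1 : B i * pSem d (K, i) (ofTest g) ≤
      (∑ i ∈ s, B i) * pSem d (K, s.sup id) (ofTest g) :=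
    mul_le_mul h0 (pSem_mono subset_rfl (Finset.le_sup (f := id) hi) _) (apply_nonneg _ _)
      (Finset.sum_nonneg fun i _ => hB i)
  refine le_trans ?_ h1
  exact (ContDiffMapSupportedIn.seminorm_top_le_iff ℂ (mul_nonneg (hB i) (apply_nonneg _ _)) i
    f).2 fun x hx => hB' i (ofTest g) K x hx

/-- The derivative is smooth with compact support, hence `M`-Lipschitz; the mean value inequality on
the ball of radius `‖v‖` about `z` gives the square. -/
lemma exists_taylor_bound {f : Smooth d} (hf : HasCompactSupport f.1) :
    ∃ M : ℝ, 0 ≤ M ∧ ∀ z v : Rn d, ‖f.1 (z + v) - f.1 z - fderiv ℝ f.1 z v‖ ≤ M * ‖v‖ ^ 2 := by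
  obtain ⟨M, hM⟩ := ContDiff.lipschitzWith_of_hasCompactSupport (𝕂 := ℝ) (n := ∞)
    (hf.fderiv (𝕜 := ℝ)) ((Smooth.contDiff f).fderiv_right (m := ∞) (by simp)) (by simp)
  refine ⟨M, M.2, fun z v => ?_⟩
  have h := Convex.norm_image_sub_le_of_norm_fderiv_le' (𝕜 := ℝ) (f := f.1)
    (φ := fderiv ℝ f.1 z) (s := Metric.closedBall z ‖v‖) (C := M * ‖v‖)
    (x := z) (y := z + v) (fun x _ => Smooth.differentiableAt f x) (fun x hx => ?_)
    (convex_closedBall _ _) (Metric.mem_closedBall_self (norm_nonneg _)) (by simp)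
  · simpa [pow_two, mul_assoc] using h
  · rw [← dist_eq_norm]
    exact (hM.dist_le_mul x z).trans (mul_le_mul_of_nonneg_left hx M.2)

lemma fderiv_apply_eq_sum (f : Smooth d) (z v : Rn d) :
    fderiv ℝ f.1 z v = ∑ j, (v j : ℂ) * (pd j f).1 z := by
  have hv : v = ∑ j, v j • EuclideanSpace.single j (1 : ℝ) := by
    ext k
    simp [Finset.sum_apply, Pi.single_apply]
  conv_lhs => rw [hv]
  rw [map_sum]
  refine Finset.sum_congr rfl fun j _ => ?_
  rw [map_smul]
  exact Complex.real_smul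

lemma opPow_pd_affS (α : Fin d → ℕ) (a : Rn d) (f : Smooth d) :
    opPow pd α (affS 1 a f) = affS 1 a (opPow pd α f) :=
  (map_opPow (affS 1 a) (fun j f => by rw [pd_affS]; simp) α f).symm

lemma opPow_pd_pd (α : Fin d → ℕ) (j : Fin d) (f : Smooth d) :
    opPow pd α (pd j f) = pd j (opPow pd α f) :=
  (map_opPow (pd j) (fun k f => by
    rw [← Module.End.mul_apply, (pd_commute j k).eq, Module.End.mul_apply]) α f).symm

/-- The remainder of the translates of a test function. -/
def taylorRem (g : Test d) (x v : Rn d) : Test d :=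
  shiftT (x + v) g - shiftT x g - ∑ j, (v j : ℂ) • shiftT x (pdT j g)

lemma ofTest_taylorRem (g : Test d) (x v : Rn d) :
    ofTest (taylorRem g x v) = affS 1 (x + v) (ofTest g) - affS 1 x (ofTest g)
      - ∑ j, (v j : ℂ) • affS 1 x (pd j (ofTest g)) := by
  let L : Test d →ₗ[ℂ] Smooth d := ⟨⟨ofTest, fun _ _ => rfl⟩, fun _ _ => rfl⟩
  change L (taylorRem g x v) = _
  simp only [taylorRem, map_sub, map_sum, map_smul]
  rfl

/-- `∂^α` commutes with translations, so it maps the remainder of `g` to that of `∂^α g`, and the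
Taylor bound is uniform in the base point. -/
lemma exists_pSem_taylorRem_le (g : Test d) (K : Compacts (Rn d)) (i : ℕ) :
    ∃ M : ℝ, ∀ x v : Rn d, pSem d (K, i) (ofTest (taylorRem g x v)) ≤ M * ‖v‖ ^ 2 := by
  choose M hM hM' using fun α : Fin d → ℕ => exists_taylor_bound (f := opPow pd α (ofTest g))
    (g.hasCompactSupport.of_isClosed_subset (isClosed_tsupport _)
      (tsupport_opPow_pd_subset α (ofTest g)))
  refine ⟨∑ α ∈ multiIdx d i, M α, fun x v => pSem_le _ _
    (mul_nonneg (Finset.sum_nonneg fun α _ => hM α) (sq_nonneg _)) fun α hα y _ => ?_⟩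
  have h0 : M α ≤ ∑ α ∈ multiIdx d i, M α :=
    Finset.single_le_sum (fun α _ => hM α) (mem_multiIdx.2 hα)
  refine le_trans (le_of_eq_of_le ?_ (hM' α (y + x) v))
    (mul_le_mul_of_nonneg_right h0 (sq_nonneg _))
  rw [ofTest_taylorRem, fderiv_apply_eq_sum]
  simp only [map_sub, map_sum, map_smul, opPow_pd_affS, opPow_pd_pd]
  congr 1
  simp only [Submodule.coe_sub, Pi.sub_apply, Submodule.coe_sum, Finset.sum_apply,
    Submodule.coe_smul, Pi.smul_apply, affS_apply, one_smul, smul_eq_mul, add_assoc]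

/-- One compact set for all small `v`, so that one finite-order estimate for `S` applies to all
remainders. -/
lemma tsupport_taylorRem_subset (g : Test d) (x v : Rn d) (hv : ‖v‖ ≤ 1) :
    tsupport (taylorRem g x v) ⊆
      subCompact ⟨tsupport g, g.hasCompactSupport⟩ ⟨_, isCompact_closedBall x 1⟩ := by
  have hx : x ∈ Metric.closedBall x 1 := Metric.mem_closedBall_self zero_le_one
  have hxv : x + v ∈ Metric.closedBall x 1 := by simpa using hv
  set Q := subCompact ⟨tsupport g, g.hasCompactSupport⟩ ⟨_, isCompact_closedBall x 1⟩
  refine closure_minimal (fun y hy => ?_) Q.isCompact.isClosed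
  by_contra hyQ
  refine hy ?_
  have h1 : ∀ (f : Test d), tsupport f ⊆ tsupport g → ∀ a ∈ Metric.closedBall x 1,
      shiftT a f y = 0 := fun f hf a ha =>
    image_eq_zero_of_notMem_tsupport fun h => hyQ (tsupport_shiftT_subset
      (K := ⟨tsupport g, g.hasCompactSupport⟩) (L := ⟨_, isCompact_closedBall x 1⟩) hf ha h)
  have h2 : taylorRem g x v y = shiftT (x + v) g y - shiftT x g y
      - ∑ j, (v j : ℂ) • shiftT x (pdT j g) y := by
    simp [taylorRem]
  rw [h2, h1 g subset_rfl _ hxv, h1 g subset_rfl _ hx]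
  simp [h1 _ (tsupport_pdT_subset _ g) _ hx]

/-- The candidate for the derivative of `x ↦ S (g(x + ·))`. -/
def convDeriv (S : Test d →L[ℂ] ℂ) (g : Test d) (x : Rn d) : Rn d →L[ℝ] ℂ :=
  ∑ j, (EuclideanSpace.proj j : Rn d →L[ℝ] ℝ).smulRight (S (shiftT x (pdT j g)))

/-- By linearity the error of first order is `S` of the Taylor remainder, hence `O(‖v‖²)`. -/
lemma hasFDerivAt_conv (S : Test d →L[ℂ] ℂ) (g : Test d) (x : Rn d) :
    HasFDerivAt (fun x => S (shiftT x g)) (convDeriv S g x) x := by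
  obtain ⟨i, C, hC, hS⟩ := exists_norm_le_pSem S
    (subCompact ⟨tsupport g, g.hasCompactSupport⟩ ⟨_, isCompact_closedBall x 1⟩)
  obtain ⟨M, hM⟩ := exists_pSem_taylorRem_le g
    (subCompact ⟨tsupport g, g.hasCompactSupport⟩ ⟨_, isCompact_closedBall x 1⟩) i
  rw [hasFDerivAt_iff_isLittleO_nhds_zero]
  have h1 : (fun v : Rn d => S (shiftT (x + v) g) - S (shiftT x g) - convDeriv S g x v)
      =O[𝓝 0] fun v => ‖v‖ ^ 2 := by
    refine IsBigO.of_bound (C * M) ?_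
    filter_upwards [Metric.closedBall_mem_nhds (0 : Rn d) one_pos] with v hv
    have h2 : S (shiftT (x + v) g) - S (shiftT x g) - convDeriv S g x v
        = S (taylorRem g x v) := by
      simp [taylorRem, convDeriv]
    rw [h2, Real.norm_of_nonneg (sq_nonneg _), mul_assoc]
    exact (hS _ (tsupport_taylorRem_subset g x v (by simpa using hv))).trans
      (mul_le_mul_of_nonneg_left (hM x v) hC)
  exact h1.trans_isLittleO (isLittleO_norm_pow_id one_lt_two)

/-- The derivative is built from functions of the same form with `∂_j g` for `g`, so induction over
all `g` applies. -/
lemma contDiff_conv (S : Test d →L[ℂ] ℂ) (g : Test d) :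
    ContDiff ℝ ∞ fun x => S (shiftT x g) := by
  rw [contDiff_infty]
  intro n
  induction n generalizing g with
  | zero =>
    exact contDiff_zero.2 (continuous_iff_continuousAt.2 fun x =>
      (hasFDerivAt_conv S g x).continuousAt)
  | succ n ih =>
    refine contDiff_succ_iff_hasFDerivAt.2 ⟨convDeriv S g, ?_, hasFDerivAt_conv S g⟩
    refine ContDiff.sum fun j _ => ?_
    exact (ContinuousLinearMap.smulRightL ℝ (Rn d) ℂ (EuclideanSpace.proj j)).contDiff.comp
      (ih (pdT j g))

/-- The smooth function `x ↦ S (g(x + ·))`. -/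
def convS (S : Test d →L[ℂ] ℂ) : Test d →ₗ[ℂ] Smooth d where
  toFun g := ⟨fun x => S (shiftT x g), contDiff_conv S g⟩
  map_add' f g := Subtype.ext <| funext fun x => by
    change S (shiftT x (f + g)) = S (shiftT x f) + S (shiftT x g)
    rw [map_add, map_add]
  map_smul' c g := Subtype.ext <| funext fun x => by
    change S (shiftT x (c • g)) = c • S (shiftT x g)
    rw [map_smul, map_smul]

lemma pd_convS (S : Test d →L[ℂ] ℂ) (j : Fin d) (g : Test d) :
    pd j (convS S g) = convS S (pdT j g) := by
  refine Subtype.ext <| funext fun x => ?_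
  change fderiv ℝ (fun x => S (shiftT x g)) x _ = S (shiftT x (pdT j g))
  rw [(hasFDerivAt_conv S g x).fderiv]
  simp [convDeriv]

lemma affS_convS (S : Test d →L[ℂ] ℂ) (a : Rn d) (g : Test d) :
    affS 1 a (convS S g) = convS S (shiftT a g) := by
  refine Subtype.ext <| funext fun x => ?_
  change S (shiftT ((1 : ℝ) • x + a) g) = S (shiftT x (shiftT a g))
  congr 1
  ext y
  simp only [shiftT_apply, one_smul, add_assoc]

/-- For `x ∈ K` the translates are supported in `K₀ - K`, where the moderateness estimate holds with
one `N`. Further derivatives fall on `g`: they raise the order `j` but not the power of `ε`. -/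
lemma exists_pSem_convS_le {S : Idx → Test d →L[ℂ] ℂ}
    (hS : ∀ K : Compacts (Rn d), ∃ j : ℕ, ∃ c > (0 : ℝ), ∃ N : ℕ, ∃ η : Idx,
      ∀ f : Test d, tsupport f ⊆ K → ∀ ε : Idx, ε ≤ η →
        ‖S ε f‖ ≤ c * (ε : ℝ) ^ (-(N : ℝ)) * pSem d (K, j) (ofTest f))
    (K₀ K : Compacts (Rn d)) (i : ℕ) :
    ∃ (j : ℕ) (C : ℝ) (N : ℕ), ∀ᶠ ε in epsZero, ∀ g : Test d, tsupport g ⊆ K₀ →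
      pSem d (K, i) (convS (S ε) g) ≤ C * (ε : ℝ) ^ (-(N : ℝ)) * pSem d (K₀, j) (ofTest g) := by
  obtain ⟨j, c, hc, N, η, hS⟩ := hS (subCompact K₀ K)
  obtain ⟨B, hB, hB'⟩ := exists_pSem_affS_le d j
  have base : ∀ ε : Idx, ε ≤ η → ∀ g : Test d, tsupport g ⊆ K₀ →
      pSem d (K, 0) (convS (S ε) g) ≤
        c * B * (ε : ℝ) ^ (-(N : ℝ)) * pSem d (K₀, j) (ofTest g) := by
    intro ε hε g hg
    have hε0 : 0 ≤ (ε : ℝ) ^ (-(N : ℝ)) := Real.rpow_nonneg ε.2.1.le _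
    refine pSem_zero_le (mul_nonneg (mul_nonneg (mul_nonneg hc.le hB) hε0) (apply_nonneg _ _))
      fun x hx => ?_
    refine (hS _ (tsupport_shiftT_subset hg hx) ε hε).trans ?_
    have h1 : pSem d (subCompact K₀ K, j) (ofTest (shiftT x g)) ≤
        B * pSem d (K₀, j) (ofTest g) :=
      (hB' 1 x _ _ (by simp) (fun y hy => mem_affCompact (L := K) hy hx) (ofTest g)).trans
        (mul_le_mul_of_nonneg_left (pSem_le_of_tsupport hg j) hB)
    calc _ ≤ c * (ε : ℝ) ^ (-(N : ℝ)) * (B * pSem d (K₀, j) (ofTest g)) :=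
          mul_le_mul_of_nonneg_left h1 (mul_nonneg hc.le hε0)
      _ = _ := by ring
  have key : ∀ i, ∃ C : ℝ, 0 ≤ C ∧ ∀ ε : Idx, ε ≤ η → ∀ g : Test d, tsupport g ⊆ K₀ →
      pSem d (K, i) (convS (S ε) g) ≤
        C * (ε : ℝ) ^ (-(N : ℝ)) * pSem d (K₀, j + i) (ofTest g) := by
    intro i
    induction i with
    | zero => exact ⟨c * B, mul_nonneg hc.le hB, base⟩
    | succ i ih =>
      obtain ⟨C, hC, h⟩ := ih
      refine ⟨c * B + ∑ _k : Fin d, C, add_nonneg (mul_nonneg hc.le hB)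
        (Finset.sum_nonneg fun _ _ => hC), fun ε hε g hg => ?_⟩
      have hε0 : 0 ≤ (ε : ℝ) ^ (-(N : ℝ)) := Real.rpow_nonneg ε.2.1.le _
      refine (pSem_succ_le K i _).trans ?_
      rw [add_mul, add_mul, Finset.sum_mul, Finset.sum_mul]
      refine add_le_add ((base ε hε g hg).trans (mul_le_mul_of_nonneg_left
        (pSem_mono subset_rfl (by omega) _) (mul_nonneg (mul_nonneg hc.le hB) hε0)))
        (Finset.sum_le_sum fun k _ => ?_)
      rw [pd_convS]
      exact (h ε hε _ ((tsupport_pdT_subset k g).trans hg)).trans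
        (mul_le_mul_of_nonneg_left (pSem_pd K₀ (j + i) k (ofTest g)) (mul_nonneg hC hε0))
  obtain ⟨C, -, h⟩ := key i
  exact ⟨j + i, C, N, (eventually_le_epsZero η).mono fun ε hε => h ε hε⟩

end Test

/-! ### Convolution of a basic functional with a compactly supported generalized function -/

section Conv

variable {d : ℕ}

/-- `w = [(g_ε)_ε]` for test functions `g_ε` supported in the compact set `K`. -/
def IsRep (w : Gc d) (g : Idx → Test d) (K : Compacts (Rn d)) : Prop :=
  (∀ ε, tsupport (g ε) ⊆ K) ∧
    ∃ h : (fun ε => ofTest (g ε)) ∈ modNets (pSem d), incl d w = GE.mk ⟨_, h⟩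

/-- A cut-off equal to `1` near the support changes a representative within its class and gives it
supports in one compact set. -/
lemma isRep_mulS {w : Gc d} {f : modNets (pSem d)} (hf : GE.mk f = incl d w) {χ : Smooth d}
    (hχ : HasCompactSupport χ.1) (hw : mulG χ (incl d w) = incl d w) :
    IsRep w (fun ε => toTest (mulS χ (f.1 ε)) hχ.mul_right) ⟨tsupport χ.1, hχ⟩ := by
  refine ⟨fun ε => closure_mono (Function.support_mul_subset_left _ _), ?_⟩
  have h : mulG χ (GE.mk f) = incl d w := by rw [hf, hw]
  exact ⟨_, h.symm⟩

lemma exists_isRep (w : Gc d) {U : Set (Rn d)} (hU : IsOpen U) (hw : supp (incl d w) ⊆ U) :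
    ∃ (g : Idx → Test d) (K : Compacts (Rn d)), (K : Set (Rn d)) ⊆ U ∧ IsRep w g K := by
  obtain ⟨χ, hc, hχ, W, hW, hCW, hW1⟩ := exists_cutoff_compact (isCompact_supp_incl w) hU hw
  obtain ⟨f, hf⟩ := GE.mk_surjective (incl d w)
  exact ⟨_, ⟨tsupport χ.1, hc⟩, hχ, isRep_mulS hf hc (mulG_eq_self hW hW1 hCW)⟩

lemma exists_isRep' (w : Gc d) : ∃ (g : Idx → Test d) (K : Compacts (Rn d)), IsRep w g K := by
  obtain ⟨g, K, -, h⟩ := exists_isRep w isOpen_univ (Set.subset_univ _)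
  exact ⟨g, K, h⟩

lemma IsRep.add {w w' : Gc d} {g g' : Idx → Test d} {K K' : Compacts (Rn d)}
    (h : IsRep w g K) (h' : IsRep w' g' K') : IsRep (w + w') (fun ε => g ε + g' ε) (K ⊔ K') := by
  obtain ⟨h1, h2, h3⟩ := h
  obtain ⟨h1', h2', h3'⟩ := h'
  refine ⟨fun ε => (tsupport_add _ _).trans (Set.union_subset_union (h1 ε) (h1' ε)),
    (modNets (pSem d)).add_mem h2 h2', ?_⟩
  rw [map_add, h3, h3', ← map_add]
  rfl

lemma IsRep.smul {w : Gc d} {g : Idx → Test d} {K : Compacts (Rn d)} (h : IsRep w g K)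
    (a : modNum) : IsRep (GenNum.mk a • w) (fun ε => (a.1 ε : ℂ) • g ε) K := by
  obtain ⟨h1, h2, h3⟩ := h
  have h5 : ∀ ε, tsupport ((a.1 ε : ℂ) • g ε : Test d) ⊆ K := fun ε =>
    (closure_mono (Function.support_const_smul_subset (a.1 ε : ℂ) (g ε : Rn d → ℂ))).trans (h1 ε)
  have h6 : incl d (GenNum.mk a • w) = GE.mk (a • ⟨_, h2⟩) := by
    rw [map_smul, h3, GE.mk_smul]
  exact ⟨h5, (a • (⟨_, h2⟩ : modNets (pSem d))).2, h6⟩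

lemma IsRep.pdGc {w : Gc d} {g : Idx → Test d} {K : Compacts (Rn d)} (h : IsRep w g K)
    (j : Fin d) : IsRep (pdGc j w) (fun ε => pdT j (g ε)) K := by
  obtain ⟨h1, h2, h3⟩ := h
  refine ⟨fun ε => (tsupport_pdT_subset j (g ε)).trans (h1 ε), ?_⟩
  have h4 := congrArg (pdG j) h3
  exact ⟨_, h4⟩

lemma IsRep.affGc {w : Gc d} {g : Idx → Test d} {K : Compacts (Rn d)} (h : IsRep w g K)
    {a : Idx → Rn d} {L : Compacts (Rn d)} (ha : ∀ ε, a ε ∈ L) :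
    IsRep (affGc 1 (one_mul 1) a L ha w) (fun ε => shiftT (a ε) (g ε)) (subCompact K L) := by
  obtain ⟨h1, h2, h3⟩ := h
  refine ⟨fun ε => tsupport_shiftT_subset (h1 ε) (ha ε), ?_⟩
  have h4 := congrArg (affG 1 (one_mul 1) a L ha) h3
  exact ⟨_, h4⟩

/-- The estimate required of the nets of distributions which define basic functionals. -/
def ModerateDistr (S : Idx → Test d →L[ℂ] ℂ) : Prop :=
  ∀ K : Compacts (Rn d), ∃ j : ℕ, ∃ c > (0 : ℝ), ∃ N : ℕ, ∃ η : Idx,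
    ∀ f : Test d, tsupport f ⊆ K → ∀ ε : Idx, ε ≤ η →
      ‖S ε f‖ ≤ c * (ε : ℝ) ^ (-(N : ℝ)) * pSem d (K, j) (ofTest f)

variable {S : Idx → Test d →L[ℂ] ℂ}

lemma ModerateDistr.mem_modNets (hS : ModerateDistr S) {w : Gc d} {g : Idx → Test d}
    {K : Compacts (Rn d)} (h : IsRep w g K) :
    (fun ε => convS (S ε) (g ε)) ∈ modNets (pSem d) := by
  rintro ⟨K', i⟩
  obtain ⟨j, C, N, hC⟩ := exists_pSem_convS_le hS K K' i
  obtain ⟨h1, h2, -⟩ := h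
  refine ((moderate_rpow C N).mul (h2 (K, j))).mono_eventually (hC.mono fun ε hε => ?_)
  rw [abs_of_nonneg (apply_nonneg _ _)]
  exact (hε _ (h1 ε)).trans (le_abs_self _)

/-- The difference of two representing nets is negligible and supported in `K ⊔ K'`; a loss of
`ε^{-N}` keeps it negligible. -/
lemma ModerateDistr.mk_congr (hS : ModerateDistr S) {w : Gc d} {g g' : Idx → Test d}
    {K K' : Compacts (Rn d)} (h : IsRep w g K) (h' : IsRep w g' K') :
    GE.mk ⟨_, hS.mem_modNets h⟩ = GE.mk ⟨_, hS.mem_modNets h'⟩ := by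
  refine GE.mk_eq.2 fun ⟨L, i⟩ => ?_
  obtain ⟨j, C, N, hC⟩ := exists_pSem_convS_le hS (K ⊔ K') L i
  obtain ⟨h1, h2, h3⟩ := h
  obtain ⟨h1', h2', h3'⟩ := h'
  have h4 := GE.mk_eq.1 (h3.symm.trans h3') (K ⊔ K', j)
  refine ((moderate_rpow C N).mul_negligible h4).mono_eventually (hC.mono fun ε hε => ?_)
  rw [abs_of_nonneg (apply_nonneg _ _)]
  have h5 := hε (g ε - g' ε) ((tsupport_sub _ _).trans (Set.union_subset_union (h1 ε) (h1' ε)))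
  rw [map_sub] at h5
  exact h5.trans (le_abs_self _)

/-- Test functions which represent `w`. -/
def repNet (w : Gc d) : Idx → Test d := (exists_isRep' w).choose

/-- A compact set which contains the supports of the functions `repNet w`. -/
def repCompact (w : Gc d) : Compacts (Rn d) := (exists_isRep' w).choose_spec.choose

lemma isRep_repNet (w : Gc d) : IsRep w (repNet w) (repCompact w) :=
  (exists_isRep' w).choose_spec.choose_spec

/-- The map `w ↦ [x ↦ S_ε (w_ε(x + ·))]`. -/
def convG (hS : ModerateDistr S) : Gc d →ₗ[GenNum] G d where
  toFun w := GE.mk ⟨_, hS.mem_modNets (isRep_repNet w)⟩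
  map_add' w w' := by
    rw [hS.mk_congr (isRep_repNet (w + w')) ((isRep_repNet w).add (isRep_repNet w')), ← map_add]
    exact congrArg GE.mk (Subtype.ext (funext fun ε => map_add (convS (S ε)) _ _))
  map_smul' c w := by
    obtain ⟨a, rfl⟩ := GenNum.mk_surjective c
    rw [hS.mk_congr (isRep_repNet (GenNum.mk a • w)) ((isRep_repNet w).smul a), RingHom.id_apply,
      ← GE.mk_smul]
    exact congrArg GE.mk (Subtype.ext (funext fun ε => map_smul (convS (S ε)) _ _))

lemma convG_eq (hS : ModerateDistr S) {w : Gc d} {g : Idx → Test d} {K : Compacts (Rn d)}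
    (h : IsRep w g K) : convG hS w = GE.mk ⟨_, hS.mem_modNets h⟩ :=
  hS.mk_congr (isRep_repNet w) h

lemma convG_pdGc (hS : ModerateDistr S) (j : Fin d) (w : Gc d) :
    convG hS (pdGc j w) = pdG j (convG hS w) := by
  obtain ⟨g, K, h⟩ := exists_isRep' w
  rw [convG_eq hS h, convG_eq hS (h.pdGc j)]
  exact congrArg GE.mk (Subtype.ext (funext fun ε => (pd_convS (S ε) j (g ε)).symm))

lemma convG_affGc (hS : ModerateDistr S) {a : Idx → Rn d} {L : Compacts (Rn d)}
    (ha : ∀ ε, a ε ∈ L) (w : Gc d) : convG hS (affGc 1 (one_mul 1) a L ha w) =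
      affG 1 (one_mul 1) a L ha (convG hS w) := by
  obtain ⟨g, K, h⟩ := exists_isRep' w
  rw [convG_eq hS h, convG_eq hS (h.affGc ha)]
  exact congrArg GE.mk (Subtype.ext (funext fun ε => (affS_convS (S ε) (a ε) (g ε)).symm))

/-- The cut-off depends on `K` only, so `L`, `i` and `N` serve all `w` at once. That `K` is interior
to `L` is what the seminorms on `GK K` require. -/
lemma exists_val_convG_le (hS : ModerateDistr S) (K : Compacts (Rn d))
    (k : Compacts (Rn d) × ℕ) : ∃ (L : Compacts (Rn d)) (i : ℕ) (N : ℝ),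
      (K : Set (Rn d)) ⊆ interior (L : Set (Rn d)) ∧
      ∀ w : Gc d, supp (incl d w) ⊆ K →
        (incl d w).val (L, i) ≤ (convG hS w).val k + (N : EReal) := by
  obtain ⟨L, hL, hKL, -⟩ := exists_compact_between K.isCompact isOpen_univ (Set.subset_univ _)
  obtain ⟨χ, hc, hχ, W, hW, hCW, hW1⟩ := exists_cutoff_compact K.isCompact isOpen_interior hKL
  obtain ⟨j, C, N, hC⟩ := exists_pSem_convS_le hS ⟨tsupport χ.1, hc⟩ k.1 k.2
  obtain ⟨B, hB, hB'⟩ := exists_pSem_mulS_le χ j (K := ⟨tsupport χ.1, hc⟩) (L := ⟨L, hL⟩)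
    (Set.inter_subset_left.trans (hχ.trans interior_subset))
  refine ⟨⟨L, hL⟩, j, N, hKL, fun w hw => ?_⟩
  obtain ⟨f, hf⟩ := GE.mk_surjective (incl d w)
  have hrep := isRep_mulS hf hc (mulG_eq_self hW hW1 (hw.trans hCW))
  rw [convG_eq hS hrep, ← hf, GE.val_mk, GE.val_mk]
  refine netVal_le_add (C := |C| * B) (hC.mono fun ε hε => ?_)
  have hε0 : 0 ≤ (ε : ℝ) ^ (-(N : ℝ)) := Real.rpow_nonneg ε.2.1.le _
  rw [abs_of_nonneg (apply_nonneg _ _), abs_of_nonneg (apply_nonneg _ _)]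
  refine (hε _ (hrep.1 ε)).trans ?_
  calc C * (ε : ℝ) ^ (-(N : ℝ)) * pSem d (⟨tsupport χ.1, hc⟩, j) (mulS χ (f.1 ε))
      ≤ |C| * (ε : ℝ) ^ (-(N : ℝ)) * (B * pSem d (⟨L, hL⟩, j) (f.1 ε)) :=
        mul_le_mul (mul_le_mul_of_nonneg_right (le_abs_self C) hε0) (hB' _) (apply_nonneg _ _)
          (mul_nonneg (abs_nonneg C) hε0)
    _ = _ := by ring

lemma continuous_GK_of_val_le {K : Compacts (Rn d)} (T : Gc d →ₗ[GenNum] G d)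
    (h : ∀ k : Compacts (Rn d) × ℕ, ∃ (L : Compacts (Rn d)) (i : ℕ) (N : ℝ),
      (K : Set (Rn d)) ⊆ interior (L : Set (Rn d)) ∧
      ∀ w : Gc d, supp (incl d w) ⊆ K → (incl d w).val (L, i) ≤ (T w).val k + (N : EReal)) :
    Continuous (X := GK K) (Y := G d) fun w => T w.1 := by
  refine continuous_iInf_rng.2 fun k => ?_
  obtain ⟨L, i, N, hKL, hN⟩ := h k
  refine continuous_iInf_dom (i := ⟨(L, i), hKL⟩) ?_
  refine @continuous_induced_of_edist_le (GK K) (G d) (G d) (GE.pseudoEMetric _ (L, i))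
    (GE.pseudoEMetric _ k) _ _ (Real.exp N).toNNReal fun w w' => ?_
  change GE.ups k (T w.1 - T w'.1) ≤ _ * GE.ups (L, i) (incl d w.1 - incl d w'.1)
  rw [← map_sub, ← map_sub]
  refine GE.ups_le_of_val_le (hN _ ?_)
  rw [map_sub, sub_eq_add_neg, ← neg_one_smul GenNum (incl d w'.1)]
  exact (supp_add _ _).trans (Set.union_subset w.2 ((supp_smul _ _).trans w'.2))

lemma continuous_convG (hS : ModerateDistr S) (K : Compacts (Rn d)) :
    Continuous (X := GK K) (Y := G d) fun w => convG hS w.1 :=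
  continuous_GK_of_val_le _ (exists_val_convG_le hS K)

lemma continuous_mulG (χ : Smooth d) : Continuous (mulG χ) := by
  -- A constant `C` costs no power of `ε`, so each seminorm is preserved with `N = 0`.
  refine continuous_iInf_rng.2 fun k => continuous_iInf_dom (i := k) ?_
  obtain ⟨C, -, hC⟩ := exists_pSem_mulS_le χ k.2 (K := k.1) (L := k.1) Set.inter_subset_left
  exact @LipschitzWith.continuous (G d) (G d) (GE.pseudoEMetric _ k)
    (GE.pseudoEMetric _ k) (Real.exp 0).toNNReal (mulG χ) fun u u' => by
      change GE.ups k (mulG χ u - mulG χ u') ≤ _ * GE.ups k (u - u')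
      rw [← map_sub]
      refine GE.ups_le_of_val_le ?_
      obtain ⟨f, hf⟩ := GE.mk_surjective (u - u')
      rw [← hf]
      change netVal _ ≤ netVal (fun ε => pSem d k (mulS χ (f.1 ε))) + _
      refine netVal_le_add (C := C) (Eventually.of_forall fun ε => ?_)
      rw [abs_of_nonneg (apply_nonneg _ _), abs_of_nonneg (apply_nonneg _ _), neg_zero,
        Real.rpow_zero, mul_one]
      exact hC _

/-- `T` is given by the net of distributions `S`. -/
def IsGivenBy (T : Gc d →ₗ[GenNum] GenNum) (S : Idx → Test d →L[ℂ] ℂ) : Prop :=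
  ∀ (w : Gc d) (g : Idx → Test d) (K : Compacts (Rn d)), IsRep w g K →
    ∃ h : (fun ε => S ε (g ε)) ∈ modNum, T w = GenNum.mk ⟨_, h⟩

lemma delta0_convG (hS : ModerateDistr S) {T : Gc d →ₗ[GenNum] GenNum} (hT : IsGivenBy T S)
    (w : Gc d) : delta0 d (convG hS w) = T w := by
  obtain ⟨g, K, h⟩ := exists_isRep' w
  obtain ⟨h', hw⟩ := hT w g K h
  rw [convG_eq hS h, hw]
  refine congrArg GenNum.mk (Subtype.ext (funext fun ε => ?_))
  change S ε (shiftT 0 (g ε)) = S ε (g ε)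
  congr 1
  ext x
  rw [shiftT_apply, one_smul, add_zero]

/-- Point values of the convolution. -/
lemma delta0_affG_convG (hS : ModerateDistr S) {T : Gc d →ₗ[GenNum] GenNum}
    (hT : IsGivenBy T S) {a : Idx → Rn d} {L : Compacts (Rn d)} (ha : ∀ ε, a ε ∈ L) (w : Gc d) :
    delta0 d (affG 1 (one_mul 1) a L ha (convG hS w)) = T (affGc 1 (one_mul 1) a L ha w) := by
  rw [← convG_affGc, delta0_convG hS hT]

lemma pdGc_comm (i j : Fin d) (w : Gc d) : pdGc i (pdGc j w) = pdGc j (pdGc i w) := by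
  refine incl_injective ?_
  simp only [incl_pdGc]
  obtain ⟨f, hf⟩ := GE.mk_surjective (incl d w)
  rw [← hf]
  exact congrArg GE.mk (Subtype.ext (funext fun ε => LinearMap.congr_fun (pd_commute i j) (f.1 ε)))

lemma affGc_pdGc {a : Idx → Rn d} {L : Compacts (Rn d)} (ha : ∀ ε, a ε ∈ L) (j : Fin d)
    (w : Gc d) : affGc 1 (one_mul 1) a L ha (pdGc j w) =
      pdGc j (affGc 1 (one_mul 1) a L ha w) := by
  refine incl_injective ?_
  rw [incl_affGc, incl_pdGc, incl_pdGc, incl_affGc, pdG_affG, Complex.ofReal_one, map_one,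
    one_smul]

lemma opTranspose_pdGc (P : MvPolynomial (Fin d) GenNum) (j : Fin d) (w : Gc d) :
    pdGc j (opTranspose P w) = opTranspose P (pdGc j w) :=
  map_polyOp (pdGc j) (fun i x => by
    simp only [LinearMap.neg_apply, LinearMap.smul_apply, map_neg, map_smul, pdGc_comm i j]) P w

lemma affGc_opTranspose (P : MvPolynomial (Fin d) GenNum) {a : Idx → Rn d}
    {L : Compacts (Rn d)} (ha : ∀ ε, a ε ∈ L) (w : Gc d) :
    affGc 1 (one_mul 1) a L ha (opTranspose P w) =
      opTranspose P (affGc 1 (one_mul 1) a L ha w) :=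
  map_polyOp (affGc 1 (one_mul 1) a L ha) (fun i x => by
    simp only [LinearMap.neg_apply, LinearMap.smul_apply, map_neg, map_smul, affGc_pdGc]) P w

/-- Convolution with a fundamental solution inverts the transposed operator. -/
lemma convG_opTranspose (hS : ModerateDistr S) {T : Gc d →ₗ[GenNum] GenNum}
    (hT : IsGivenBy T S) {P : MvPolynomial (Fin d) GenNum} (hP : opDual P T = delta d)
    (w : Gc d) : convG hS (opTranspose P w) = incl d w := by
  -- All differences are considered together: the family is stable under `∂_j` since `∂_j` commutes
  -- with `convG` and `ᵗP(D)`.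
  refine sub_eq_zero.1 (VanishesOn.eq_zero (vanishesOn_of_pointValues
    (Z := Set.range fun w => convG hS (opTranspose P w) - incl d w) ?_ ?_ ⟨w, rfl⟩))
  · rintro _ ⟨w, rfl⟩ j
    refine ⟨pdGc j w, ?_⟩
    simp only [map_sub, ← opTranspose_pdGc, convG_pdGc, incl_pdGc]
  · rintro _ ⟨w, rfl⟩ a L ha -
    simp only [map_sub]
    -- At `a_ε` both terms are `δ` of the translated `w`: translations commute with `ᵗP(D)`, and `T
    -- ∘ ᵗP(D) = δ`.
    rw [delta0_affG_convG hS hT, affGc_opTranspose, ← incl_affGc, ← delta_apply, ← hP]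
    exact sub_self _

/-- The convolution vanishes on `V` if the translates `w(x + ·)`, `x ∈ V`, are supported away from
the support of the functional. -/
lemma vanishesOn_convG (hS : ModerateDistr S) {T : Gc d →ₗ[GenNum] GenNum}
    (hT : IsGivenBy T S) {V U : Set (Rn d)}
    (hU : ∀ x ∈ V, ∀ y ∈ dsupp T, x + y ∉ U) {w : Gc d} (hw : supp (incl d w) ⊆ U) :
    VanishesOn (convG hS w) V := by
  refine vanishesOn_of_pointValues
    (Z := (convG hS) '' {w | supp (incl d w) ⊆ U}) ?_ ?_ ⟨w, hw, rfl⟩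
  · rintro _ ⟨w, hw, rfl⟩ j
    exact ⟨pdGc j w, (supp_pdG j _).trans hw, convG_pdGc hS j w⟩
  · rintro _ ⟨w, hw, rfl⟩ a L ha hL
    rw [delta0_affG_convG hS hT]
    -- A point `y` of the translate's support is `z - b` with `z` in the support of `w` and `b ∈ L ⊆
    -- V`; if `y` were in `dsupp T`, then `b + y = z` would contradict `hU`.
    refine apply_eq_zero_of_disjoint_dsupp T _ (Set.disjoint_left.2 fun y hy hyT => ?_)
    obtain ⟨⟨z, b⟩, ⟨hz, hb⟩, rfl⟩ := supp_affG_subset (hs := one_mul 1) (ha := ha)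
      (isCompact_supp_incl w) hy
    refine hU b (hL hb) _ hyT ?_
    simpa using hw hz

end Conv

/-! ### Evolution operators -/

section Evolution

variable {d : ℕ}

lemma zero_mem_singleton : (0 : Rn d) ∈ (⟨{0}, isCompact_singleton⟩ : Compacts (Rn d)) := rfl

/-- The reflection `y ↦ -y` on the Colombeau algebra. -/
def reflG (d : ℕ) : Module.End GenNum (G d) :=
  affG (-1) (by norm_num) (fun _ => 0) ⟨{0}, isCompact_singleton⟩
    fun _ => zero_mem_singleton

/-- The reflection `y ↦ -y` on compactly supported generalized functions. -/
def reflGc (d : ℕ) : Module.End GenNum (Gc d) :=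
  affGc (-1) (by norm_num) (fun _ => 0) ⟨{0}, isCompact_singleton⟩
    fun _ => zero_mem_singleton

lemma incl_reflGc (w : Gc d) : incl d (reflGc d w) = reflG d (incl d w) := rfl

lemma reflG_reflG (u : G d) : reflG d (reflG d u) = u := by
  obtain ⟨f, rfl⟩ := GE.mk_surjective u
  refine congrArg GE.mk (Subtype.ext (funext fun ε => Subtype.ext (funext fun x => ?_)))
  change (f.1 ε).1 ((-1 : ℝ) • ((-1 : ℝ) • x + 0) + 0) = (f.1 ε).1 x
  simp

lemma pdG_reflG (j : Fin d) (u : G d) : pdG j (reflG d u) = -reflG d (pdG j u) := by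
  rw [reflG, pdG_affG, Complex.ofReal_neg, Complex.ofReal_one, map_neg, map_one, neg_one_smul]

/-- Reflection turns `D_j` into `-D_j`, hence `P(D)` into `P(-D)`. -/
lemma opG_reflG (P : MvPolynomial (Fin d) GenNum) (u : G d) :
    opG P (reflG d u) =
      reflG d (polyOp (fun j => -(GenNum.const (-Complex.I) • pdG j)) P u) :=
  (map_polyOp (reflG d) (fun j x => by
    simp only [LinearMap.neg_apply, LinearMap.smul_apply, map_neg, map_smul, pdG_reflG,
      smul_neg]) P u).symm

variable {S : Idx → Test d →L[ℂ] ℂ}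

lemma polyOp_convG (hS : ModerateDistr S) (P : MvPolynomial (Fin d) GenNum) (w : Gc d) :
    convG hS (opTranspose P w) =
      polyOp (fun j => -(GenNum.const (-Complex.I) • pdG j)) P (convG hS w) :=
  map_polyOp (convG hS) (fun j x => by
    simp only [LinearMap.neg_apply, LinearMap.smul_apply, map_neg, map_smul, convG_pdGc]) P w

lemma opG_reflG_convG (hS : ModerateDistr S) {T : Gc d →ₗ[GenNum] GenNum}
    (hT : IsGivenBy T S) {P : MvPolynomial (Fin d) GenNum} (hP : opDual P T = delta d)
    (v : Gc d) : opG P (reflG d (convG hS (reflGc d v))) = incl d v := by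
  rw [opG_reflG, ← polyOp_convG, convG_opTranspose hS hT hP, incl_reflGc, reflG_reflG]

lemma vanishesOn_empty (u : G d) : VanishesOn u ∅ := vanishesOn_of_locally fun _ hx => hx.elim

lemma VanishesOn.val_eq_top {u : G d} {V : Set (Rn d)} (h : VanishesOn u V)
    {K : Compacts (Rn d)} (hK : (K : Set (Rn d)) ⊆ V) (i : ℕ) : u.val (K, i) = ⊤ := by
  obtain ⟨f, rfl⟩ := GE.mk_surjective u
  exact netVal_of_negligible (vanishesOn_mk.1 h K hK i)

/-- `u` need not have compact support, so it is approximated by `χ_k u` with `χ_k = 1` near the ball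
of radius `k`. The functional kills each `χ_k u`, and continuity passes this to `u`. -/
lemma DualG.apply_eq_zero_of_disjoint (v : DualG d) (u : G d)
    (h : Disjoint (supp u) (dsupp v.res)) : v u = 0 := by
  choose χ hc hχ W hW hCW hW1 using fun k : ℕ => exists_cutoff_compact (U := Set.univ)
    (isCompact_closedBall (0 : Rn d) k) isOpen_univ (Set.subset_univ _)
  have h0 : ∀ k, v (mulG (χ k) u) = 0 := fun k =>
    apply_eq_zero_of_disjoint_dsupp v.res (mulToGc (χ k) (hc k) u)
      (h.mono_left ((supp_mulG_subset _ _).trans Set.inter_subset_right))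
  have hlim : Tendsto (fun k => mulG (χ k) u) atTop (𝓝 u) := by
    rw [nhds_iInf, tendsto_iInf]
    rintro ⟨K, i⟩
    obtain ⟨M, hM⟩ := K.isCompact.isBounded.subset_closedBall (0 : Rn d)
    obtain ⟨k₀, hk₀⟩ := exists_nat_ge M
    let _ := GE.pseudoEMetric (pSem d) (K, i)
    refine (@EMetric.tendsto_nhds _ _ (GE.pseudoEMetric (pSem d) (K, i)) _ _ _).2
      fun r hr => (eventually_ge_atTop k₀).mono fun k hk => lt_of_eq_of_lt ?_ hr
    rw [edist_comm]
    change GE.ups (K, i) (u - mulG (χ k) u) = 0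
    -- Once the ball of radius `k` contains `K`, the difference vanishes near `K` and its seminorm
    -- is exactly `0`.
    have hKW : (K : Set (Rn d)) ⊆ W k := (hM.trans (Metric.closedBall_subset_closedBall
      (hk₀.trans (by exact_mod_cast hk)))).trans (hCW k)
    have h1 : VanishesOn (u - mulG (χ k) u) (W k) := by
      rw [← mulG_one_sub]
      exact vanishesOn_mulG (vanishesOn_empty u) fun x hx =>
        tsupport_one_sub_subset (hW k) (hW1 k) hx.2 hx.1
    rw [GE.ups, h1.val_eq_top hKW i]
    simp
  have h1 : Tendsto (fun k => v (mulG (χ k) u)) atTop (𝓝 (v u)) :=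
    (v.continuous.tendsto u).comp hlim
  simp only [h0] at h1
  -- The constant sequence `0` tends to `v u`; separation of points forces equality.
  refine (GenNum.eq_of_edist ?_).symm
  by_contra hne
  obtain ⟨-, h2⟩ := (EMetric.tendsto_nhds.1 h1 _ (pos_iff_ne_zero.2 hne)).exists
  exact lt_irrefl _ h2

end Evolution

/-! ### The three solutions and their supports -/

section HalfSpace

variable {m : ℕ} {S : Idx → Test (m + 1) →L[ℂ] ℂ}

/-- A real level strictly between `x_n` and the infimum; for empty `A` the infimum is `+∞` and such
a level still exists. -/
lemma exists_real_of_notMem_above {A : Set (Rn (m + 1))} {x : Rn (m + 1)} (hx : x ∉ above A) :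
    ∃ c : ℝ, x (Fin.last m) < c ∧ ∀ y ∈ A, c < y (Fin.last m) := by
  obtain ⟨c, h1, h2⟩ := EReal.lt_iff_exists_real_btwn.1 (not_le.1 hx)
  exact ⟨c, by exact_mod_cast h1, fun y hy => by
    exact_mod_cast h2.trans_le (iInf₂_le (f := fun (y : Rn (m + 1)) (_ : y ∈ A) =>
      ((y (Fin.last m) : ℝ) : EReal)) y hy)⟩

lemma continuous_last : Continuous fun x : Rn (m + 1) => x (Fin.last m) := by fun_prop

lemma isOpen_last_lt (c : ℝ) : IsOpen {x : Rn (m + 1) | x (Fin.last m) < c} :=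
  isOpen_lt continuous_last continuous_const

/-- If `x_n ≥ c` and `y` is in the support of `T`, then `x_n + y_n ≥ c`, so `x + y` lies off the
support of `w`. -/
lemma vanishesOn_convG_of_supp_lt (hS : ModerateDistr S) {T : Gc (m + 1) →ₗ[GenNum] GenNum}
    (hT : IsGivenBy T S) (hsupp : dsupp T ⊆ halfSpace m) {c : ℝ} {w : Gc (m + 1)}
    (hw : supp (incl (m + 1) w) ⊆ {x | x (Fin.last m) < c}) :
    VanishesOn (convG hS w) {x | c ≤ x (Fin.last m)} := by
  refine vanishesOn_convG hS hT (fun x hx y hy hxy => ?_) hw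
  have h1 : 0 ≤ y (Fin.last m) := hsupp hy
  have h2 : c ≤ x (Fin.last m) := hx
  have h3 : x (Fin.last m) + y (Fin.last m) < c := hxy
  linarith

lemma supp_convG_subset (hS : ModerateDistr S) {T : Gc (m + 1) →ₗ[GenNum] GenNum}
    (hT : IsGivenBy T S) (hsupp : dsupp T ⊆ halfSpace m) {c : ℝ} {w : Gc (m + 1)}
    (hw : supp (incl (m + 1) w) ⊆ {x | x (Fin.last m) < c}) :
    supp (convG hS w) ⊆ {x | x (Fin.last m) ≤ c} :=
  supp_subset_of_vanishesOn (isClosed_le continuous_last continuous_const)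
    ((vanishesOn_convG_of_supp_lt hS hT hsupp hw).mono fun x hx => by
      have h : ¬ x (Fin.last m) ≤ c := hx
      exact (not_le.1 h).le)

/-- The solution in the Colombeau algebra. -/
lemma exists_solution_G {P : MvPolynomial (Fin (m + 1)) GenNum} (hS : ModerateDistr S)
    {T : Gc (m + 1) →ₗ[GenNum] GenNum} (hT : IsGivenBy T S) (hsupp : dsupp T ⊆ halfSpace m)
    (hP : opDual P T = delta (m + 1)) (v : Gc (m + 1)) :
    ∃ u : G (m + 1), opG P u = incl (m + 1) v ∧ supp u ⊆ above (supp (incl (m + 1) v)) := by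
  refine ⟨_, opG_reflG_convG hS hT hP v, fun x hx => ?_⟩
  by_contra hxv
  obtain ⟨c, hxc, hc⟩ := exists_real_of_notMem_above hxv
  -- The reflected `v` lies in `{z_n < -c}`, so its convolution vanishes where `z_n ≥ -c`;
  -- reflecting back, `u` vanishes where `y_n ≤ c`, near `x`.
  have h1 : supp (incl (m + 1) (reflGc (m + 1) v)) ⊆ {z | z (Fin.last m) < -c} := by
    intro z hz
    obtain ⟨⟨y, b⟩, ⟨hy, hb⟩, rfl⟩ :=
      supp_affG_subset (hs := by norm_num) (ha := fun _ => zero_mem_singleton)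
        (isCompact_supp_incl v) hz
    have hb0 : b = 0 := hb
    have := hc y hy
    simpa [hb0] using this
  refine hx {y | y (Fin.last m) < c} (isOpen_last_lt c) hxc
    (vanishesOn_affG (vanishesOn_convG_of_supp_lt hS hT hsupp h1) fun y hy b hb => ?_)
  have hb0 : b = 0 := hb
  have hy' : y (Fin.last m) < c := hy
  simpa [hb0] using hy'.le

/-- The solution for functionals on the Colombeau algebra. -/
lemma exists_solution_dualG {P : MvPolynomial (Fin (m + 1)) GenNum} (hS : ModerateDistr S)
    {T : Gc (m + 1) →ₗ[GenNum] GenNum} (hT : IsGivenBy T S) (hsupp : dsupp T ⊆ halfSpace m)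
    (hP : opDual P T = delta (m + 1)) (v : DualG (m + 1)) :
    ∃ u : DualGc (m + 1), opDual P u.toLinearMap = v.res ∧
      dsupp u.toLinearMap ⊆ above (dsupp v.res) := by
  refine ⟨⟨v.toLinearMap ∘ₗ convG hS, continuous_of_forall_GK _ fun K =>
    v.continuous.comp (continuous_convG hS K)⟩, LinearMap.ext fun w => ?_, fun x hx => ?_⟩
  · change v (convG hS (opTranspose P w)) = v (incl (m + 1) w)
    rw [convG_opTranspose hS hT hP]
  · by_contra hxv
    obtain ⟨c, hxc, hc⟩ := exists_real_of_notMem_above hxv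
    obtain ⟨w, hw, hne⟩ := hx _ (isOpen_last_lt c) hxc
    -- `convG w` lives in `{y_n ≤ c}` and `v` in `{y_n > c}`.
    refine hne (v.apply_eq_zero_of_disjoint (convG hS w) (Set.disjoint_left.2 fun y hy hyv => ?_))
    exact (hc y hyv).not_ge (supp_convG_subset hS hT hsupp hw hy)

/-- On the compact set of unit vectors of `Γ` the last coordinate is positive, hence at least some
`δ > 0`; homogeneity extends the bound to the cone. -/
lemma exists_mul_norm_le_of_cone {Γ : Set (Rn (m + 1))} (hΓ : IsClosed Γ)
    (hcone : ∀ x ∈ Γ, ∀ t : ℝ, 0 < t → t • x ∈ Γ) (hH : Γ ⊆ halfSpace m)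
    (h0 : Γ ∩ {x | x (Fin.last m) = 0} = {0}) :
    ∃ δ : ℝ, 0 < δ ∧ ∀ x ∈ Γ, δ * ‖x‖ ≤ x (Fin.last m) := by
  have hc : IsCompact (Γ ∩ Metric.sphere 0 1) := (isCompact_sphere 0 1).inter_left hΓ
  obtain ⟨δ, hδ, h⟩ := hc.exists_forall_le' (f := fun x => x (Fin.last m)) (a := 0)
    continuous_last.continuousOn fun x hx => by
      refine lt_of_le_of_ne (hH hx.1) fun h => ?_
      have : x ∈ Γ ∩ {x | x (Fin.last m) = 0} := ⟨hx.1, h.symm⟩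
      rw [h0] at this
      have hx0 : x = 0 := this
      have hx1 : ‖x‖ = 1 := by simpa using hx.2
      rw [hx0, norm_zero] at hx1
      exact zero_ne_one hx1
  refine ⟨δ, hδ, fun x hx => ?_⟩
  rcases eq_or_ne x 0 with rfl | hx0
  · simp
  · have hn : 0 < ‖x‖ := norm_pos_iff.2 hx0
    have h1 := h (‖x‖⁻¹ • x) ⟨hcone x hx _ (inv_pos.2 hn), by simp [norm_smul, hn.ne']⟩
    have h2 : δ ≤ ‖x‖⁻¹ * x (Fin.last m) := h1
    calc δ * ‖x‖ ≤ ‖x‖⁻¹ * x (Fin.last m) * ‖x‖ := mul_le_mul_of_nonneg_right h2 hn.le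
      _ = x (Fin.last m) := by field_simp

/-- The solution for functionals supported in a cone. -/
lemma exists_solution_cone {P : MvPolynomial (Fin (m + 1)) GenNum} (hS : ModerateDistr S)
    {T : Gc (m + 1) →ₗ[GenNum] GenNum} (hT : IsGivenBy T S) (hsupp : dsupp T ⊆ halfSpace m)
    (hP : opDual P T = delta (m + 1)) (v : DualGc (m + 1)) {Γ : Set (Rn (m + 1))}
    (hΓ : IsClosed Γ) (hcone : ∀ x ∈ Γ, ∀ t : ℝ, 0 < t → t • x ∈ Γ) (hH : Γ ⊆ halfSpace m)
    (h0 : Γ ∩ {x | x (Fin.last m) = 0} = {0}) (hv : dsupp v.toLinearMap ⊆ Γ) :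
    ∃ u : DualGc (m + 1), opDual P u.toLinearMap = v.toLinearMap ∧
      dsupp u.toLinearMap ⊆ halfSpace m := by
  obtain ⟨δ, hδ, hδΓ⟩ := exists_mul_norm_le_of_cone hΓ hcone hH h0
  -- The summand `1` opens up the cone to a neighbourhood, also at the apex, yet keeps it bounded
  -- below each level of `x_n`.
  obtain ⟨ψ, hψ, W, hW, hΓW, hW1⟩ := exists_cutoff (C := Γ)
    (U := {x | δ * ‖x‖ < x (Fin.last m) + 1}) hΓ
    (isOpen_lt (by fun_prop) (continuous_last.add continuous_const))
    fun x hx => (hδΓ x hx).trans_lt (lt_add_one _)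
  have hcpt : ∀ K : Compacts (Rn (m + 1)), ∃ L : Compacts (Rn (m + 1)), ∀ w : Gc (m + 1),
      supp (incl (m + 1) w) ⊆ K → supp (mulG ψ (convG hS w)) ⊆ L := by
    intro K
    obtain ⟨M, hM⟩ := K.isCompact.isBounded.exists_norm_le
    -- On the support, `δ ‖x‖ < x_n + 1` by the choice of `ψ`, and `x_n ≤ M + 1` since `w` lies in
    -- `{z_n < M + 1}`; hence the radius `(M + 2) / δ`.
    refine ⟨⟨_, isCompact_closedBall (0 : Rn (m + 1)) ((M + 2) / δ)⟩, fun w hw x hx => ?_⟩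
    have hx' := supp_mulG_subset _ _ hx
    have h1 : δ * ‖x‖ < x (Fin.last m) + 1 := hψ hx'.1
    have h2 : x (Fin.last m) ≤ M + 1 := supp_convG_subset hS hT hsupp (fun z hz =>
      ((le_abs_self _).trans ((PiLp.norm_apply_le z (Fin.last m)).trans (hM z (hw hz)))).trans_lt
        (lt_add_one M)) hx'.2
    change x ∈ Metric.closedBall 0 _
    rw [mem_closedBall_zero_iff, le_div_iff₀ hδ]
    linarith
  let B : Gc (m + 1) →ₗ[GenNum] Gc (m + 1) :=
    (mulG ψ ∘ₗ convG hS).codRestrict (cptSupp (m + 1)) fun w => by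
      obtain ⟨L, hL⟩ := hcpt ⟨_, isCompact_supp_incl w⟩
      exact L.isCompact.of_isClosed_subset (isClosed_supp _) (hL w subset_rfl)
  have hB : ∀ w, incl (m + 1) (B w) = mulG ψ (convG hS w) := fun w => rfl
  have hcont : Continuous (v.toLinearMap ∘ₗ B) := by
    refine continuous_of_forall_GK _ fun K => ?_
    obtain ⟨L, hL⟩ := hcpt K
    let F : GK K → GK L := fun w => ⟨B w.1, hL w.1 w.2⟩
    -- The topology of `GK L` is induced by some of the seminorms of `G`, so continuity into `G`
    -- suffices.
    have hF : Continuous F := continuous_iInf_rng.2 fun k => continuous_induced_rng.2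
      (continuous_iInf_rng.1 ((continuous_mulG ψ).comp (continuous_convG hS K)) k.1)
    exact v.continuous.comp ((continuous_val_GK L).comp hF)
  refine ⟨⟨v.toLinearMap ∘ₗ B, hcont⟩, LinearMap.ext fun w => ?_, fun x hx => ?_⟩
  · change v (B (opTranspose P w)) = v w
    refine (sub_eq_zero.1 ?_).symm
    rw [← map_sub]
    refine apply_eq_zero_of_disjoint_dsupp v.toLinearMap _
      (Set.disjoint_left.2 fun y hy hyv => ?_)
    -- The difference is `(1 - ψ) w`, supported off the neighbourhood `W` of `Γ`.
    rw [map_sub, hB, convG_opTranspose hS hT hP, ← mulG_one_sub] at hy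
    exact tsupport_one_sub_subset hW hW1 (supp_mulG_subset _ _ hy).1 (hΓW (hv hyv))
  · by_contra hxH
    have hx0 : x (Fin.last m) < 0 := not_le.1 hxH
    -- The level `x_n / 2` leaves room on both sides: `x` is below it, and `B w` lives at or below
    -- it, strictly under the half space that carries `v`.
    obtain ⟨w, hw, hne⟩ := hx {y | y (Fin.last m) < x (Fin.last m) / 2} (isOpen_last_lt _)
      (show x (Fin.last m) < x (Fin.last m) / 2 by linarith)
    refine hne (apply_eq_zero_of_disjoint_dsupp v.toLinearMap (B w)
      (Set.disjoint_left.2 fun y hy hyv => ?_))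
    have h1 : y (Fin.last m) ≤ x (Fin.last m) / 2 :=
      supp_convG_subset hS hT hsupp hw (supp_mulG_subset _ _ hy).2
    have h2 : 0 ≤ y (Fin.last m) := hH (hv hyv)
    linarith

end HalfSpace

end Colombeau

end

theorem mainTheorem7 (m : ℕ) (P : MvPolynomial (Fin (m + 1)) GenNum)
    (hP : IsEvolutionOperator P) :
    (∀ v : Gc (m + 1), ∃ u : G (m + 1),
      opG P u = incl (m + 1) v ∧ supp u ⊆ above (supp (incl (m + 1) v))) ∧
    (∀ v : DualG (m + 1), ∃ u : DualGc (m + 1),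
      opDual P u.toLinearMap = v.res ∧ dsupp u.toLinearMap ⊆ above (dsupp v.res)) ∧
    (∀ (v : DualGc (m + 1)) (Γ : Set (Rn (m + 1))), IsClosed Γ →
      (∀ x ∈ Γ, ∀ t : ℝ, 0 < t → t • x ∈ Γ) → Γ ⊆ halfSpace m →
      Γ ∩ {x | x (Fin.last m) = 0} = {0} → dsupp v.toLinearMap ⊆ Γ →
      ∃ u : DualGc (m + 1),
        opDual P u.toLinearMap = v.toLinearMap ∧ dsupp u.toLinearMap ⊆ halfSpace m) := by
  obtain ⟨E, ⟨S, hS, hE⟩, hP, hsupp⟩ := hP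
  have hT : IsGivenBy E.toLinearMap S := fun w g K h => hE K g h.1 h.2.1 w h.2.2
  exact ⟨exists_solution_G hS hT hsupp hP, exists_solution_dualG hS hT hsupp hP,
    fun v Γ hΓ hcone hH h0 hv => exists_solution_cone hS hT hsupp hP v hΓ hcone hH h0 hv⟩
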